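/- Consider $n\ge 1$ secretaries arriving in uniformly random order, with ranks $r_1,\dots,r_n$ forming a uniformly random permutation of $\{1,\dots,n\}$ (rank $n$ is best). Secretary $i$ carries advice $s_i\in\{Y,N\}$; given the ranks, the $s_i$ are independent, with $\mathbb P[s_i=Y\mid r_i=n]=p$ (recall) and $\mathbb P[s_i=N\mid r_i=k]=p'$ for every $k<n$ (specificity), where $p,p'\in[\tfrac12,1]$. At time $i$ a policy sees $s_1,\dots,s_i$ and the relative order of the first $i$ secretaries, and decides, possibly at random, whether to stop at $i$; it succeeds if it stops at the secretary of rank $n$. For $t_Y,t_N\in\{1,\dots,n\}$, the threshold policy $(t_Y,t_N)$ stops at the first secretary $i$ that is the best so far and satisfies $i\ge t_{s_i}$. Let $\mathsf{Opt}(n,p,p')$ be the optimal value of the linear program $$\max\ \sum_{i=1}^n\frac1n\left[p\,z_i^Y+(1-p)z_i^N\right]\quad\text{s.t.}\quad z_i^s\le 1-\sum_{j<i}\frac1j\left[(1-p')z_j^Y+p'z_j^N\right],\quad z_i^s\in[0,1]\quad(1\le i\le n,\ s\in\{Y,N\}),$$ and let $\mathsf{Opt}(p,p')=\inf_{n\ge1}\mathsf{Opt}(n,p,p')$.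 **Theorem.** Let $p,p'\in[\tfrac12,1]$, and put $0^0=1$ in the formulas below. 1. For every $n\ge1$ there are thresholds $1\le t_Y\le t_N\le n$ such that the threshold policy $(t_Y,t_N)$ maximizes the success probability among all policies, and its success probability is $\mathsf{Opt}(n,p,p')$. 2. If for every $n\ge1$ the thresholds $1\le t_Y(n)\le t_N(n)\le n$ define an optimal policy, then, as $n\to\infty$, $$\frac{t_N(n)}n\to e^{p/p'-1/p'},\qquad \frac{t_Y(n)}n\to\left(\frac{1-p'}p\right)^{1/p'}e^{p/p'-1/p'}.$$ 3. The limiting optimal success probability exists and bounds $\mathsf{Opt}(p,p')$ from below: $$\mathsf{Opt}(p,p')\ \ge\ \lim_{n\to\infty}\mathsf{Opt}(n,p,p')=\left(\frac{1-p'}p\right)^{(1-p')/p'}e^{p/p'-1/p'}.$$ -/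

import Mathlib

namespace BinaryAdvice

/-- The advice given for a secretary: Y(es) or N(o). -/
inductive Signal where
  | Y : Signal
  | N : Signal
  deriving DecidableEq

instance : Fintype Signal where
  elems := {Signal.Y, Signal.N}
  complete x := by cases x <;> simp

/-- The rank in `{1, ..., n}` of the secretary arriving at (0-based) position `i`; the best
secretary has rank `n`. -/
def rank {n : ℕ} (r : Equiv.Perm (Fin n)) (i : Fin n) : ℕ := (r i : ℕ) + 1

/-- Conditional probability of a signal for a secretary of rank `k` among `n`: recall `p`,
specificity `p'`. -/
noncomputable def signalProb (p p' : ℝ) (n k : ℕ) : Signal → ℝ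
  | Signal.Y => if k = n then p else 1 - p'
  | Signal.N => if k = n then 1 - p else p'

/-- Joint law of ranks and signals: the ranks are a uniformly random permutation and, given the
ranks, the signals are independent. -/
noncomputable def jointProb (n : ℕ) (p p' : ℝ) (r : Equiv.Perm (Fin n)) (s : Fin n → Signal) : ℝ :=
  1 / (Nat.factorial n : ℝ) * ∏ i, signalProb p p' n (rank r i) (s i)

/-- The event that secretary `i` is the best so far. -/
def BestSoFar {n : ℕ} (r : Equiv.Perm (Fin n)) (i : Fin n) : Prop :=
  ∀ j, j < i → rank r j ≤ rank r i

/-- Two outcomes give the same information up to and including time `i`: the same relative order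
of the secretaries seen so far, and the same signals. -/
def SameInfo {n : ℕ} (i : Fin n) (r r' : Equiv.Perm (Fin n)) (s s' : Fin n → Signal) : Prop :=
  (∀ j k, j ≤ i → k ≤ i → (rank r j ≤ rank r k ↔ rank r' j ≤ rank r' k)) ∧
    ∀ j, j ≤ i → s j = s' j

/-- A (randomized, history-dependent) stopping policy: `accept i r s` is the probability of
accepting secretary `i` if no earlier one was accepted; it is a function of the information
available at time `i`. -/
structure Policy (n : ℕ) where
  accept : Fin n → Equiv.Perm (Fin n) → (Fin n → Signal) → ℝ
  accept_nonneg : ∀ i r s, 0 ≤ accept i r s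
  accept_le_one : ∀ i r s, accept i r s ≤ 1
  adapted : ∀ i r r' s s', SameInfo i r r' s s' → accept i r s = accept i r' s'

/-- The probability, given the outcome, that the policy picks secretary `i`. -/
noncomputable def Policy.pickProb {n : ℕ} (π : Policy n) (r : Equiv.Perm (Fin n))
    (s : Fin n → Signal) (i : Fin n) : ℝ :=
  π.accept i r s * ∏ j ∈ Finset.univ.filter (fun j => j < i), (1 - π.accept j r s)

/-- The probability that the policy picks the best secretary. -/
noncomputable def Policy.successProb {n : ℕ} (π : Policy n) (p p' : ℝ) : ℝ :=
  ∑ r : Equiv.Perm (Fin n), ∑ s : Fin n → Signal,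
    jointProb n p p' r s * ∑ i, if rank r i = n then π.pickProb r s i else 0

/-- The policy is optimal among all policies. -/
def Policy.IsOptimal {n : ℕ} (π : Policy n) (p p' : ℝ) : Prop :=
  ∀ π' : Policy n, π'.successProb p p' ≤ π.successProb p p'

/-- The pair of time thresholds as a function of the signal. -/
def thresholds (tY tN : ℕ) : Signal → ℕ
  | Signal.Y => tY
  | Signal.N => tN

open Classical in
/-- The threshold policy: accept the first secretary who is the best so far, has signal `σ`, and
arrives at a time (counted from 1) no earlier than the threshold of `σ`. -/
noncomputable def thresholdPolicy (n tY tN : ℕ) : Policy n where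
  accept i r s := if BestSoFar r i ∧ thresholds tY tN (s i) ≤ (i : ℕ) + 1 then 1 else 0
  accept_nonneg i r s := by split_ifs <;> norm_num
  accept_le_one i r s := by split_ifs <;> norm_num
  adapted i r r' s s' h := by
    have h1 : BestSoFar r i ↔ BestSoFar r' i :=
      forall_congr' fun j => imp_congr_right fun hj => h.1 j i hj.le le_rfl
    simp only [h1, h.2 i le_rfl]

/-- Feasibility in the primal linear program for `n` periods; `z i s` stands for the probability of
picking `i` given that `i` is the best so far with signal `s`. -/
def LPFeasible (n : ℕ) (p' : ℝ) (z : ℕ → Signal → ℝ) : Prop :=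
  ∀ i ∈ Finset.Icc 1 n, ∀ s : Signal, 0 ≤ z i s ∧ z i s ≤ 1 ∧
    z i s ≤ 1 - ∑ j ∈ Finset.Ico 1 i,
      1 / (j : ℝ) * ((1 - p') * z j Signal.Y + p' * z j Signal.N)

/-- Objective of the primal linear program. -/
noncomputable def lpObjective (n : ℕ) (p : ℝ) (z : ℕ → Signal → ℝ) : ℝ :=
  ∑ i ∈ Finset.Icc 1 n, 1 / (n : ℝ) * (p * z i Signal.Y + (1 - p) * z i Signal.N)

/-- `Opt(n, p, p')`: the optimal value of the primal linear program. -/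
noncomputable def optN (n : ℕ) (p p' : ℝ) : ℝ :=
  sSup {v : ℝ | ∃ z : ℕ → Signal → ℝ, LPFeasible n p' z ∧ v = lpObjective n p z}

/-- `Opt(p, p')`: the infimum of `Opt(n, p, p')` over `n ≥ 1`. -/
noncomputable def opt (p p' : ℝ) : ℝ :=
  sInf {v : ℝ | ∃ n : ℕ, 1 ≤ n ∧ v = optN n p p'}

end BinaryAdvice

/-!
# Secretaries with binary advice

Throughout, `q` is the specificity `p'`.

**Policies and the linear program.** As long as the best secretary has not arrived, the signals
seen are pure noise: independent, with law `noise q`. Under the null law, where all the signals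
are noise, the event that `i` is best so far has probability `1 / i` and is independent of the
earlier relative order (`sum_BestSoFar_of_prefixInvariant`); given this event `i` is the best of
all with probability `i / n` (`sum_rank_eq_of_prefixInvariant`), which only changes the law of the
`i`-th signal. Hence the probabilities of picking `i`, given that `i` is best so far with signal
`σ`, form a feasible point of the linear program whose objective is the success probability
(`Policy.successProb_eq_lpObjective`). For a threshold policy the constraints are tight from the
thresholds on (`thresholdPolicy_toLP`).

**Dynamic programming.** Let `W i = optValue p q n i` solve `W (n + 1) = 0`,
`W i = W (i + 1) + surplus (W (i + 1) / i)`. The objective of a point of the linear program is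
`W 1 / n` minus a sum of losses, nonnegative for feasible points (`lpObjective_eq`). Since `W`
decreases, accepting a signal is profitable exactly from some time on (`exists_thresholds`), and the corresponding
threshold policy has no losses. Conversely an optimal threshold policy has no losses, which pins
down the sign of the margins next to its thresholds (`margin_of_isOptimal`).

**The limit.** The function `w = limitValue p q` on `[0, 1]` solves `-w' = surplus (w / x)`,
`w 1 = 0`, and is concave. Comparing the tangents of `w` with the steps of the dynamic program
gives `n * w (i / n) ≤ W (i + 1) ≤ n * w (i / n) + 1` for every `n` (`optValue_bounds`): the
errors of the single steps are bounded by the increments of `-w'`, which telescope. At `i = 0`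
this is `w 0 ≤ optN n p q ≤ w 0 + 1 / n` (`optN_bounds`); together with the signs of
the margins it places the thresholds within `2` of `n * limitY p q` and `n * limitN p q`, the
points where the margins of the limit vanish.
-/

namespace BinaryAdvice

/-! ### Relative orders of a uniformly random permutation -/

/-- A function of the permutation that depends only on the relative order of the values at the
first `m` positions. -/
def PrefixInvariant {n : ℕ} (m : ℕ) (g : Equiv.Perm (Fin n) → ℝ) : Prop :=
  ∀ r r' : Equiv.Perm (Fin n),
    (∀ j k : Fin n, (j : ℕ) < m → (k : ℕ) < m → (rank r j ≤ rank r k ↔ rank r' j ≤ rank r' k)) →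
      g r = g r'

/-- The permutation of `Fin (n + 1)` that takes the value `v` at the last position and whose other
values are ordered as those of `r`. -/
def snocPerm {n : ℕ} (v : Fin (n + 1)) (r : Equiv.Perm (Fin n)) : Equiv.Perm (Fin (n + 1)) :=
  (finSuccEquiv' (Fin.last n)).trans ((Equiv.optionCongr r).trans (finSuccEquiv' v).symm)

@[simp] lemma snocPerm_last {n : ℕ} (v : Fin (n + 1)) (r : Equiv.Perm (Fin n)) :
    snocPerm v r (Fin.last n) = v := by
  simp [snocPerm]

@[simp] lemma snocPerm_castSucc {n : ℕ} (v : Fin (n + 1)) (r : Equiv.Perm (Fin n)) (j : Fin n) :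
    snocPerm v r j.castSucc = v.succAbove (r j) := by
  have : finSuccEquiv' (Fin.last n) j.castSucc = some j := by
    rw [← Fin.succAbove_last_apply, finSuccEquiv'_succAbove]
  simp [snocPerm, this]

lemma snocPerm_bijective (n : ℕ) :
    Function.Bijective (fun x : Fin (n + 1) × Equiv.Perm (Fin n) => snocPerm x.1 x.2) := by
  rw [Fintype.bijective_iff_injective_and_card]
  refine ⟨?_, by simp [Fintype.card_perm, Nat.factorial_succ]⟩
  rintro ⟨v, r⟩ ⟨v', r'⟩ h
  have hv : v = v' := by
    have := congrArg (fun e : Equiv.Perm (Fin (n + 1)) => e (Fin.last n)) h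
    simpa using this
  subst hv
  have hr : r = r' := by
    ext j
    have := congrArg (fun e : Equiv.Perm (Fin (n + 1)) => e j.castSucc) h
    simp only [snocPerm_castSucc] at this
    rw [Fin.succAbove_right_injective this]
  rw [hr]

lemma sum_perm_succ {n : ℕ} (F : Equiv.Perm (Fin (n + 1)) → ℝ) :
    ∑ r, F r = ∑ v, ∑ r, F (snocPerm v r) := by
  rw [← Fintype.sum_bijective _ (snocPerm_bijective n) (fun x => F (snocPerm x.1 x.2)) F
    fun _ => rfl, Fintype.sum_prod_type]

lemma rank_le_rank_iff {n : ℕ} (r : Equiv.Perm (Fin n)) (j k : Fin n) :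
    rank r j ≤ rank r k ↔ r j ≤ r k := by
  rw [rank, rank, add_le_add_iff_right, Fin.le_def]

lemma rank_snocPerm_castSucc_le_iff {n : ℕ} (v : Fin (n + 1)) (r : Equiv.Perm (Fin n))
    (j k : Fin n) :
    rank (snocPerm v r) j.castSucc ≤ rank (snocPerm v r) k.castSucc ↔ rank r j ≤ rank r k := by
  simp [rank_le_rank_iff]

lemma rank_eq_iff_eq_last {n : ℕ} (r : Equiv.Perm (Fin (n + 1))) (i : Fin (n + 1)) :
    rank r i = n + 1 ↔ r i = Fin.last n := by
  simp [rank, Fin.ext_iff]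

lemma BestSoFar_of_rank_eq {n : ℕ} {r : Equiv.Perm (Fin n)} {i : Fin n} (h : rank r i = n) :
    BestSoFar r i := by
  intro j _
  rw [h]
  exact (r j).isLt

lemma BestSoFar_last_iff {n : ℕ} (r : Equiv.Perm (Fin (n + 1))) :
    BestSoFar r (Fin.last n) ↔ r (Fin.last n) = Fin.last n := by
  refine ⟨fun h => ?_, fun h => BestSoFar_of_rank_eq ((rank_eq_iff_eq_last _ _).2 h)⟩
  obtain ⟨j, hj⟩ := r.surjective (Fin.last n)
  rcases (Fin.le_last j).lt_or_eq with hlt | rfl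
  · have := h j hlt
    rw [rank_le_rank_iff, hj] at this
    exact le_antisymm (Fin.le_last _) this
  · exact hj

lemma BestSoFar_snocPerm_castSucc_iff {n : ℕ} (v : Fin (n + 1)) (r : Equiv.Perm (Fin n))
    (i : Fin n) : BestSoFar (snocPerm v r) i.castSucc ↔ BestSoFar r i := by
  constructor
  · intro h j hj
    exact (rank_snocPerm_castSucc_le_iff v r j i).1 (h j.castSucc (by simpa using hj))
  · intro h j hj
    obtain ⟨j, rfl⟩ : ∃ j' : Fin n, j = j'.castSucc :=
      ⟨⟨j, lt_trans hj i.isLt⟩, rfl⟩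
    exact (rank_snocPerm_castSucc_le_iff v r j i).2 (h j (by simpa using hj))

lemma PrefixInvariant.snocPerm_eq {n m : ℕ} (hm : m ≤ n) {g : Equiv.Perm (Fin (n + 1)) → ℝ}
    (hg : PrefixInvariant m g) (v v' : Fin (n + 1)) (r : Equiv.Perm (Fin n)) :
    g (snocPerm v r) = g (snocPerm v' r) := by
  refine hg _ _ fun j k hj hk => ?_
  obtain ⟨j, rfl⟩ : ∃ j' : Fin n, j = j'.castSucc := ⟨⟨j, by omega⟩, rfl⟩
  obtain ⟨k, rfl⟩ : ∃ k' : Fin n, k = k'.castSucc := ⟨⟨k, by omega⟩, rfl⟩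
  simp only [rank_snocPerm_castSucc_le_iff]

lemma PrefixInvariant.comp_snocPerm {n m : ℕ} (hm : m ≤ n) {g : Equiv.Perm (Fin (n + 1)) → ℝ}
    (hg : PrefixInvariant m g) (v : Fin (n + 1)) :
    PrefixInvariant m (fun r => g (snocPerm v r)) := by
  intro r r' h
  refine hg _ _ fun j k hj hk => ?_
  obtain ⟨j, rfl⟩ : ∃ j' : Fin n, j = j'.castSucc := ⟨⟨j, by omega⟩, rfl⟩
  obtain ⟨k, rfl⟩ : ∃ k' : Fin n, k = k'.castSucc := ⟨⟨k, by omega⟩, rfl⟩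
  simp only [rank_snocPerm_castSucc_le_iff]
  exact h j k hj hk

open Classical in
/-- Being best so far at time `i` has probability `1 / (i + 1)` (times are counted from `0`) and is
independent of the relative order of the earlier secretaries. -/
lemma sum_BestSoFar_of_prefixInvariant {n : ℕ} (i : Fin n) (g : Equiv.Perm (Fin n) → ℝ)
    (hg : PrefixInvariant i g) :
    ((i : ℝ) + 1) * ∑ r, (if BestSoFar r i then g r else 0) = ∑ r, g r := by
  induction n with
  | zero => exact i.elim0
  | succ n ih =>
    rw [sum_perm_succ, sum_perm_succ g]
    induction i using Fin.lastCases with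
    | last =>
      have h1 : ∀ v : Fin (n + 1), ∑ r, g (snocPerm v r) = ∑ r, g (snocPerm (Fin.last n) r) :=
        fun v => Finset.sum_congr rfl fun r _ => hg.snocPerm_eq (by simp) _ _ _
      simp only [BestSoFar_last_iff, snocPerm_last, h1]
      rw [Finset.sum_eq_single (Fin.last n) (by intro b _ hb; simp [hb]) (by simp)]
      simp
    | cast i =>
      have hm : ((i.castSucc : Fin (n + 1)) : ℕ) ≤ n := by simp
      simp only [BestSoFar_snocPerm_castSucc_iff]
      have h1 : ∀ v : Fin (n + 1), ∀ r, g (snocPerm v r) = g (snocPerm (Fin.last n) r) :=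
        fun v r => hg.snocPerm_eq hm _ _ _
      simp only [h1]
      have := ih i (fun r => g (snocPerm (Fin.last n) r)) (hg.comp_snocPerm hm _)
      simp only [Finset.sum_const, nsmul_eq_mul]
      rw [← this]
      simp only [Fin.val_castSucc]
      ring

open Classical in
/-- A secretary that is best so far at time `i` is the best of all with probability
`(i + 1) / n`, independently of the relative order observed so far. -/
lemma sum_rank_eq_of_prefixInvariant {n : ℕ} (i : Fin n) (g : Equiv.Perm (Fin n) → ℝ)
    (hg : PrefixInvariant (i + 1) g) :
    (n : ℝ) * ∑ r, (if rank r i = n then g r else 0) =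
      ((i : ℝ) + 1) * ∑ r, (if BestSoFar r i then g r else 0) := by
  induction n with
  | zero => exact i.elim0
  | succ n ih =>
    simp only [rank_eq_iff_eq_last]
    induction i using Fin.lastCases with
    | last => simp [BestSoFar_last_iff]
    | cast i =>
      rw [sum_perm_succ, sum_perm_succ]
      have hm : ((i.castSucc : Fin (n + 1)) : ℕ) + 1 ≤ n := by simp
      obtain ⟨n, rfl⟩ : ∃ n', n = n' + 1 := ⟨n - 1, by have := i.isLt; omega⟩
      have h1 : ∀ v : Fin (n + 1 + 1), ∀ r, g (snocPerm v r) = g (snocPerm (Fin.last _) r) :=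
        fun v r => hg.snocPerm_eq hm _ _ _
      have h2 : ∀ v : Fin (n + 1 + 1), ∀ r : Equiv.Perm (Fin (n + 1)),
          v.succAbove (r i) = Fin.last (n + 1) ↔ v ≠ Fin.last (n + 1) ∧ r i = Fin.last n := by
        intro v r
        by_cases hv : v = Fin.last (n + 1)
        · subst hv
          simp [Fin.succAbove_last_apply, (Fin.castSucc_lt_last _).ne]
        · rw [Fin.succAbove_eq_last_iff hv]
          simp [hv]
      simp only [BestSoFar_snocPerm_castSucc_iff, snocPerm_castSucc, h1, h2]
      have := ih i (fun r => g (snocPerm (Fin.last (n + 1)) r)) (hg.comp_snocPerm hm _)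
      simp only [rank_eq_iff_eq_last] at this
      simp only [ite_and]
      have h3 : ∀ v : Fin (n + 1 + 1),
          (∑ r : Equiv.Perm (Fin (n + 1)), if v ≠ Fin.last (n + 1) then
            (if r i = Fin.last n then g (snocPerm (Fin.last (n + 1)) r) else 0) else 0) =
          if v ≠ Fin.last (n + 1) then ∑ r : Equiv.Perm (Fin (n + 1)),
            (if r i = Fin.last n then g (snocPerm (Fin.last (n + 1)) r) else 0) else 0 := by
        intro v
        split_ifs <;> simp
      simp only [h3, ← Finset.sum_filter, Finset.sum_const, nsmul_eq_mul]
      simp only [Finset.sum_filter]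
      rw [Finset.filter_ne', Finset.card_erase_of_mem (Finset.mem_univ _)]
      simp only [Finset.card_univ, Fintype.card_fin, Fin.val_castSucc] at this ⊢
      push_cast at this ⊢
      linear_combination ((n : ℝ) + 1 + 1) * this

/-! ### The law of the signals -/

/-- The law of the signal of a secretary that is not the best one. -/
def noise (q : ℝ) : Signal → ℝ
  | Signal.Y => 1 - q
  | Signal.N => q

/-- The law of the signal of the best secretary. -/
def bestLaw (p : ℝ) : Signal → ℝ
  | Signal.Y => p
  | Signal.N => 1 - p

lemma sum_signal (f : Signal → ℝ) : ∑ σ, f σ = f Signal.Y + f Signal.N := by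
  change ∑ σ ∈ {Signal.Y, Signal.N}, f σ = _
  rw [Finset.sum_insert (by simp), Finset.sum_singleton]

lemma sum_noise (q : ℝ) : ∑ σ, noise q σ = 1 := by
  rw [sum_signal]; simp [noise]

lemma noise_nonneg {q : ℝ} (h0 : 0 ≤ q) (h1 : q ≤ 1) (σ : Signal) : 0 ≤ noise q σ := by
  cases σ <;> simp [noise] <;> linarith

/-- Expectation when the ranks form a uniformly random permutation and all the signals, that of the
best secretary included, are independent with law `noise q`. Before the best secretary arrives this
law cannot be told from the true one. -/
noncomputable def nullExp {n : ℕ} (q : ℝ) (f : Equiv.Perm (Fin n) → (Fin n → Signal) → ℝ) : ℝ :=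
  ∑ r, ∑ s, 1 / (Nat.factorial n : ℝ) * (∏ j, noise q (s j)) * f r s

/-- Replacing the law of the `i`-th signal, `noise q`, by another law `u`. -/
lemma sum_prod_update {n : ℕ} {q : ℝ} (u : Signal → ℝ) (i : Fin n) (f : (Fin n → Signal) → ℝ) :
    ∑ s : Fin n → Signal, (u (s i) * ∏ j ∈ Finset.univ.erase i, noise q (s j)) * f s =
      ∑ σ, u σ * ∑ s : Fin n → Signal, (∏ j, noise q (s j)) * f (Function.update s i σ) := by
  have key : ∑ x : (Fin n → Signal) × Signal,
        noise q x.2 * ((u (x.1 i) * ∏ j ∈ Finset.univ.erase i, noise q (x.1 j)) * f x.1) =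
      ∑ x : (Fin n → Signal) × Signal,
        u x.2 * ((∏ j, noise q (x.1 j)) * f (Function.update x.1 i x.2)) := by
    -- exchange the `i`-th signal with the additional one
    refine Finset.sum_nbij' (fun x => (Function.update x.1 i x.2, x.1 i))
      (fun x => (Function.update x.1 i x.2, x.1 i)) (by simp) (by simp) (by simp) (by simp) ?_
    rintro ⟨s, σ⟩ -
    have h : ∏ j ∈ Finset.univ.erase i, noise q (Function.update s i σ j) =
        ∏ j ∈ Finset.univ.erase i, noise q (s j) :=
      Finset.prod_congr rfl fun j hj => by
        rw [Function.update_of_ne (Finset.ne_of_mem_erase hj)]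
    simp only [Function.update_idem, Function.update_eq_self]
    rw [← Finset.mul_prod_erase Finset.univ _ (Finset.mem_univ i), h]
    simp only [Function.update_self]
    ring
  rw [Fintype.sum_prod_type_right, Fintype.sum_prod_type_right] at key
  simp only [← Finset.mul_sum] at key
  rw [← Finset.sum_mul, sum_noise, one_mul] at key
  exact key

lemma nullExp_congr {n : ℕ} {q : ℝ} {f g : Equiv.Perm (Fin n) → (Fin n → Signal) → ℝ}
    (h : ∀ r s, f r s = g r s) : nullExp q f = nullExp q g := by
  simp only [nullExp, h]

lemma nullExp_mono {n : ℕ} {q : ℝ} (h0 : 0 ≤ q) (h1 : q ≤ 1)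
    {f g : Equiv.Perm (Fin n) → (Fin n → Signal) → ℝ}
    (h : ∀ r s, f r s ≤ g r s) : nullExp q f ≤ nullExp q g := by
  refine Finset.sum_le_sum fun r _ => Finset.sum_le_sum fun s _ =>
    mul_le_mul_of_nonneg_left (h r s) ?_
  have := Finset.prod_nonneg fun j (_ : j ∈ Finset.univ) => noise_nonneg h0 h1 (s j)
  positivity

lemma nullExp_sub {n : ℕ} {q : ℝ} (f g : Equiv.Perm (Fin n) → (Fin n → Signal) → ℝ) :
    nullExp q (fun r s => f r s - g r s) = nullExp q f - nullExp q g := by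
  simp only [nullExp, mul_sub, Finset.sum_sub_distrib]

lemma nullExp_sum {n : ℕ} {q : ℝ} {ι : Type*} (t : Finset ι)
    (f : ι → Equiv.Perm (Fin n) → (Fin n → Signal) → ℝ) :
    nullExp q (fun r s => ∑ k ∈ t, f k r s) = ∑ k ∈ t, nullExp q (f k) := by
  simp only [nullExp, Finset.mul_sum]
  rw [Finset.sum_comm (s := t)]
  exact Finset.sum_congr rfl fun r _ => Finset.sum_comm

lemma nullExp_zero {n : ℕ} {q : ℝ} : nullExp q (fun (_ : Equiv.Perm (Fin n)) _ => 0) = 0 := by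
  simp [nullExp]

lemma sum_prod_noise (n : ℕ) (q : ℝ) : ∑ s : Fin n → Signal, ∏ j, noise q (s j) = 1 := by
  rw [← Fintype.prod_sum (fun _ σ => noise q σ)]
  simp [sum_noise]

lemma nullExp_one {n : ℕ} {q : ℝ} : nullExp q (fun (_ : Equiv.Perm (Fin n)) _ => 1) = 1 := by
  simp only [nullExp, mul_one, ← Finset.mul_sum, sum_prod_noise]
  simp [Fintype.card_perm, Nat.factorial_ne_zero]

/-- The `i`-th signal may be sampled afresh. -/
lemma nullExp_resample {n : ℕ} {q : ℝ} (i : Fin n)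
    (f : Equiv.Perm (Fin n) → (Fin n → Signal) → ℝ) :
    nullExp q f = ∑ σ, noise q σ * nullExp q (fun r s => f r (Function.update s i σ)) := by
  simp only [nullExp, mul_assoc, ← Finset.mul_sum]
  have h := fun r => sum_prod_update (q := q) (noise q) i (f r)
  simp only [Finset.mul_prod_erase Finset.univ (fun j => noise q _) (Finset.mem_univ i)] at h
  simp only [h]
  rw [Finset.sum_comm]
  simp only [Finset.mul_sum]
  refine Finset.sum_congr rfl fun σ _ => Finset.sum_congr rfl fun r _ =>
    Finset.sum_congr rfl fun s _ => by ring

open Classical in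
/-- On the event that the `i`-th secretary is the best, the true law is the null law with the `i`-th
signal sampled afresh from `bestLaw p`. -/
lemma sum_jointProb_rank_eq {n : ℕ} {p q : ℝ} (i : Fin n)
    (f : Equiv.Perm (Fin n) → (Fin n → Signal) → ℝ) :
    ∑ r, ∑ s, jointProb n p q r s * (if rank r i = n then f r s else 0) =
      ∑ σ, bestLaw p σ *
        nullExp q (fun r s => if rank r i = n then f r (Function.update s i σ) else 0) := by
  have h : ∀ r : Equiv.Perm (Fin n),
      ∑ s, jointProb n p q r s * (if rank r i = n then f r s else 0) =
      ∑ σ, bestLaw p σ * ∑ s : Fin n → Signal, 1 / (Nat.factorial n : ℝ) *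
        (∏ j, noise q (s j)) * (if rank r i = n then f r (Function.update s i σ) else 0) := by
    intro r
    by_cases hr : rank r i = n
    · have hprod : ∀ s : Fin n → Signal, ∏ j, signalProb p q n (rank r j) (s j) =
          bestLaw p (s i) * ∏ j ∈ Finset.univ.erase i, noise q (s j) := by
        intro s
        rw [← Finset.mul_prod_erase Finset.univ _ (Finset.mem_univ i)]
        congr 1
        · cases hs : s i <;> simp [signalProb, bestLaw, hr]
        · refine Finset.prod_congr rfl fun j hj => ?_
          have hj' : rank r j ≠ n := by
            intro h
            apply Finset.ne_of_mem_erase hj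
            apply r.injective
            simp only [rank] at h hr
            exact Fin.ext (by omega)
          cases hs : s j <;> simp [signalProb, noise, hj']
      simp only [jointProb, hprod, hr, if_true, mul_assoc, ← Finset.mul_sum]
      have := sum_prod_update (q := q) (bestLaw p) i (f r)
      simp only [mul_assoc] at this
      rw [this, Finset.mul_sum]
      exact Finset.sum_congr rfl fun σ _ => by ring
    · simp [hr]
  simp only [h]
  rw [Finset.sum_comm]
  simp only [nullExp, Finset.mul_sum]

open Classical in
lemma nullExp_BestSoFar {n : ℕ} {q : ℝ} (i : Fin n)
    (f : Equiv.Perm (Fin n) → (Fin n → Signal) → ℝ)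
    (hf : ∀ s, PrefixInvariant i (fun r => f r s)) :
    ((i : ℝ) + 1) * nullExp q (fun r s => if BestSoFar r i then f r s else 0) = nullExp q f := by
  simp only [nullExp]
  rw [Finset.sum_comm, Finset.sum_comm (f := fun r s => _ * f r s), Finset.mul_sum]
  refine Finset.sum_congr rfl fun s _ => ?_
  rw [← Finset.mul_sum, ← Finset.mul_sum, ← sum_BestSoFar_of_prefixInvariant i _ (hf s)]
  ring

open Classical in
lemma nullExp_rank_eq {n : ℕ} {q : ℝ} (i : Fin n)
    (f : Equiv.Perm (Fin n) → (Fin n → Signal) → ℝ)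
    (hf : ∀ s, PrefixInvariant (i + 1) (fun r => f r s)) :
    (n : ℝ) * nullExp q (fun r s => if rank r i = n then f r s else 0) =
      ((i : ℝ) + 1) * nullExp q (fun r s => if BestSoFar r i then f r s else 0) := by
  simp only [nullExp]
  rw [Finset.sum_comm, Finset.sum_comm (f := fun r s => _ * (if BestSoFar r i then f r s else 0)),
    Finset.mul_sum, Finset.mul_sum]
  refine Finset.sum_congr rfl fun s _ => ?_
  rw [← Finset.mul_sum, ← Finset.mul_sum]
  linear_combination (1 / (Nat.factorial n : ℝ) * ∏ j, noise q (s j)) *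
    sum_rank_eq_of_prefixInvariant i _ (hf s)

/-! ### From policies to the linear program -/

lemma Policy.prod_eq_of_agree {n : ℕ} (π : Policy n) (i : Fin n) {r r' : Equiv.Perm (Fin n)}
    {s s' : Fin n → Signal}
    (hr : ∀ j k : Fin n, (j : ℕ) < i → (k : ℕ) < i →
      (rank r j ≤ rank r k ↔ rank r' j ≤ rank r' k))
    (hs : ∀ j, j < i → s j = s' j) :
    ∏ j ∈ Finset.univ.filter (fun j => j < i), (1 - π.accept j r s) =
      ∏ j ∈ Finset.univ.filter (fun j => j < i), (1 - π.accept j r' s') := by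
  refine Finset.prod_congr rfl fun j hj => ?_
  have hj : j < i := by simpa using hj
  rw [π.adapted j r r' s s' ⟨fun a b ha hb => hr a b (lt_of_le_of_lt ha hj) (lt_of_le_of_lt hb hj),
    fun a ha => hs a (lt_of_le_of_lt ha hj)⟩]

lemma Policy.pickProb_eq_of_agree {n : ℕ} (π : Policy n) (i : Fin n) {r r' : Equiv.Perm (Fin n)}
    (s : Fin n → Signal)
    (hr : ∀ j k : Fin n, (j : ℕ) < i + 1 → (k : ℕ) < i + 1 →
      (rank r j ≤ rank r k ↔ rank r' j ≤ rank r' k)) :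
    π.pickProb r s i = π.pickProb r' s i := by
  unfold Policy.pickProb
  rw [π.prod_eq_of_agree i (s := s) (s' := s)
    (fun j k hj hk => hr j k (by omega) (by omega)) fun _ _ => rfl,
    π.adapted i r r' s s ⟨fun j k hj hk => hr j k (Nat.lt_succ_of_le hj) (Nat.lt_succ_of_le hk),
      fun _ _ => rfl⟩]

lemma Policy.prod_nonneg {n : ℕ} (π : Policy n) (i : Fin n) (r : Equiv.Perm (Fin n))
    (s : Fin n → Signal) :
    0 ≤ ∏ j ∈ Finset.univ.filter (fun j => j < i), (1 - π.accept j r s) :=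
  Finset.prod_nonneg fun j _ => sub_nonneg.2 (π.accept_le_one j r s)

lemma Policy.pickProb_nonneg {n : ℕ} (π : Policy n) (r : Equiv.Perm (Fin n))
    (s : Fin n → Signal) (i : Fin n) : 0 ≤ π.pickProb r s i :=
  mul_nonneg (π.accept_nonneg i r s) (π.prod_nonneg i r s)

lemma Policy.pickProb_le_prod {n : ℕ} (π : Policy n) (r : Equiv.Perm (Fin n))
    (s : Fin n → Signal) (i : Fin n) :
    π.pickProb r s i ≤ ∏ j ∈ Finset.univ.filter (fun j => j < i), (1 - π.accept j r s) :=
  mul_le_of_le_one_left (π.prod_nonneg i r s) (π.accept_le_one i r s)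

/-- Either an earlier secretary is picked or all of them are passed over. -/
lemma Policy.prod_eq_one_sub_sum {n : ℕ} (π : Policy n) (r : Equiv.Perm (Fin n))
    (s : Fin n → Signal) (i : Fin n) :
    ∏ j ∈ Finset.univ.filter (fun j => j < i), (1 - π.accept j r s) =
      1 - ∑ j ∈ Finset.univ.filter (fun j => j < i), π.pickProb r s j := by
  rw [Finset.prod_one_sub_ordered]
  congr 1
  refine Finset.sum_congr rfl fun j hj => ?_
  have hj : j < i := by simpa using hj
  unfold Policy.pickProb
  congr 1
  refine Finset.prod_congr ?_ fun _ _ => rfl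
  ext k
  simp only [Finset.mem_filter, Finset.mem_univ, true_and]
  exact ⟨fun h => h.2, fun h => ⟨h.trans hj, h⟩⟩

open Classical in
/-- The probability that the policy picks secretary `i` given that `i` is best so far with signal
`σ`. -/
noncomputable def Policy.condPick {n : ℕ} (π : Policy n) (q : ℝ) (i : Fin n) (σ : Signal) : ℝ :=
  ((i : ℝ) + 1) * nullExp q
    (fun r s => if BestSoFar r i then π.pickProb r (Function.update s i σ) i else 0)

/-- The probability, under the null law, that none of the secretaries before `i` is picked. -/
noncomputable def Policy.survival {n : ℕ} (π : Policy n) (q : ℝ) (i : Fin n) : ℝ :=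
  nullExp q (fun r s => ∏ j ∈ Finset.univ.filter (fun j => j < i), (1 - π.accept j r s))

/-- The point of the linear program given by a policy. -/
noncomputable def Policy.toLP {n : ℕ} (π : Policy n) (q : ℝ) (i : ℕ) (σ : Signal) : ℝ :=
  if h : i - 1 < n then π.condPick q ⟨i - 1, h⟩ σ else 0

lemma Policy.toLP_succ {n : ℕ} (π : Policy n) (q : ℝ) (i : Fin n) (σ : Signal) :
    π.toLP q (i + 1) σ = π.condPick q i σ := by
  simp [Policy.toLP]

/-- Success is decided by the conditional picking probabilities alone. -/
lemma Policy.successProb_eq {n : ℕ} (π : Policy n) (p q : ℝ) :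
    π.successProb p q = ∑ i : Fin n, 1 / (n : ℝ) *
      (p * π.condPick q i Signal.Y + (1 - p) * π.condPick q i Signal.N) := by
  classical
  have h1 : π.successProb p q = ∑ i : Fin n, ∑ r, ∑ s,
      jointProb n p q r s * (if rank r i = n then π.pickProb r s i else 0) := by
    unfold Policy.successProb
    simp only [Finset.mul_sum]
    rw [Finset.sum_comm (s := (Finset.univ : Finset (Fin n)))]
    exact Finset.sum_congr rfl fun r _ => Finset.sum_comm
  rw [h1]
  refine Finset.sum_congr rfl fun i _ => ?_
  have hn : (n : ℝ) ≠ 0 := Nat.cast_ne_zero.2 i.pos.ne'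
  have h2 : p * π.condPick q i Signal.Y + (1 - p) * π.condPick q i Signal.N =
      ∑ σ, bestLaw p σ * π.condPick q i σ := by
    rw [sum_signal]
    rfl
  rw [sum_jointProb_rank_eq i (fun r s => π.pickProb r s i), h2, Finset.mul_sum]
  refine Finset.sum_congr rfl fun σ _ => ?_
  have := nullExp_rank_eq (q := q) i (fun r s => π.pickProb r (Function.update s i σ) i)
    fun s r r' h => π.pickProb_eq_of_agree i _ h
  rw [Policy.condPick, ← this]
  field_simp

lemma Policy.condPick_nonneg {n : ℕ} (π : Policy n) {q : ℝ} (h0 : 0 ≤ q) (h1 : q ≤ 1) (i : Fin n)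
    (σ : Signal) : 0 ≤ π.condPick q i σ := by
  refine mul_nonneg (by positivity) ?_
  refine nullExp_zero.symm.trans_le (nullExp_mono h0 h1 fun r s => ?_)
  split_ifs
  · exact π.pickProb_nonneg _ _ _
  · exact le_rfl

open Classical in
lemma Policy.survival_eq {n : ℕ} (π : Policy n) (q : ℝ) (i : Fin n) (σ : Signal) :
    π.survival q i = ((i : ℝ) + 1) * nullExp q (fun r s => if BestSoFar r i then
      ∏ j ∈ Finset.univ.filter (fun j => j < i), (1 - π.accept j r (Function.update s i σ))
      else 0) := by
  rw [nullExp_BestSoFar i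
    (fun r s => ∏ j ∈ Finset.univ.filter (fun j => j < i),
      (1 - π.accept j r (Function.update s i σ)))
    fun s r r' h => π.prod_eq_of_agree i h fun _ _ => rfl]
  exact nullExp_congr fun r s => π.prod_eq_of_agree i (fun _ _ _ _ => Iff.rfl) fun j hj => by
    rw [Function.update_of_ne hj.ne]

lemma Policy.condPick_le_survival {n : ℕ} (π : Policy n) {q : ℝ} (h0 : 0 ≤ q) (h1 : q ≤ 1)
    (i : Fin n) (σ : Signal) : π.condPick q i σ ≤ π.survival q i := by
  classical
  rw [π.survival_eq q i σ]
  refine mul_le_mul_of_nonneg_left (nullExp_mono h0 h1 fun r s => ?_) (by positivity)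
  split_ifs
  · exact π.pickProb_le_prod _ _ _
  · exact le_rfl

lemma Policy.survival_le_one {n : ℕ} (π : Policy n) {q : ℝ} (h0 : 0 ≤ q) (h1 : q ≤ 1)
    (i : Fin n) : π.survival q i ≤ 1 := by
  rw [← nullExp_one (n := n) (q := q)]
  exact nullExp_mono h0 h1 fun r s => Finset.prod_le_one
    (fun j _ => sub_nonneg.2 (π.accept_le_one j r s)) fun j _ => by
      linarith [π.accept_nonneg j r s]

open Classical in
/-- The unconditional probability of picking a secretary that is best so far. -/
lemma Policy.nullExp_pick_BestSoFar {n : ℕ} (π : Policy n) (q : ℝ) (j : Fin n) :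
    nullExp q (fun r s => if BestSoFar r j then π.pickProb r s j else 0) =
      1 / ((j : ℝ) + 1) *
        ((1 - q) * π.condPick q j Signal.Y + q * π.condPick q j Signal.N) := by
  have hj : ((j : ℝ) + 1) ≠ 0 := by positivity
  rw [nullExp_resample j, sum_signal]
  simp only [Policy.condPick, noise]
  field_simp

lemma Policy.survival_eq_one_sub {n : ℕ} (π : Policy n) (q : ℝ) (i : Fin n) :
    π.survival q i = 1 - ∑ j ∈ Finset.univ.filter (fun j => j < i),
      nullExp q (fun r s => π.pickProb r s j) := by
  rw [Policy.survival, nullExp_congr fun r s => π.prod_eq_one_sub_sum r s i, nullExp_sub,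
    nullExp_one, nullExp_sum]

lemma Policy.survival_le {n : ℕ} (π : Policy n) {q : ℝ} (h0 : 0 ≤ q) (h1 : q ≤ 1) (i : Fin n) :
    π.survival q i ≤ 1 - ∑ j ∈ Finset.univ.filter (fun j => j < i), 1 / ((j : ℝ) + 1) *
        ((1 - q) * π.condPick q j Signal.Y + q * π.condPick q j Signal.N) := by
  classical
  rw [π.survival_eq_one_sub]
  refine sub_le_sub_left (Finset.sum_le_sum fun j _ => ?_) _
  rw [← π.nullExp_pick_BestSoFar]
  refine nullExp_mono h0 h1 fun r s => ?_
  split_ifs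
  · exact le_rfl
  · exact π.pickProb_nonneg _ _ _

/-- The mass that a point of the linear program leaves for the times from `i` on. -/
noncomputable def lpMass (q : ℝ) (z : ℕ → Signal → ℝ) (i : ℕ) : ℝ :=
  1 - ∑ j ∈ Finset.Ico 1 i, 1 / (j : ℝ) * ((1 - q) * z j Signal.Y + q * z j Signal.N)

lemma sum_Icc_eq_sum_fin (n : ℕ) (F : ℕ → ℝ) :
    ∑ i ∈ Finset.Icc 1 n, F i = ∑ i : Fin n, F (i + 1) := by
  rw [Fin.sum_univ_eq_sum_range (fun i => F (i + 1)) n, Finset.range_eq_Ico,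
    Finset.sum_Ico_add' F 0 n 1]
  rfl

lemma sum_Ico_eq_sum_fin {n : ℕ} (i : Fin n) (F : ℕ → ℝ) :
    ∑ j ∈ Finset.Ico 1 ((i : ℕ) + 1), F j =
      ∑ j ∈ Finset.univ.filter (fun j : Fin n => j < i), F (j + 1) := by
  symm
  refine Finset.sum_bij (fun j _ => (j : ℕ) + 1) ?_ ?_ ?_ (fun _ _ => rfl)
  · intro j hj
    have : j < i := by simpa using hj
    simp only [Finset.mem_Ico]
    omega
  · intro a _ b _ h
    exact Fin.ext (by omega)
  · intro b hb
    simp only [Finset.mem_Ico] at hb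
    refine ⟨⟨b - 1, by omega⟩, ?_, by simp; omega⟩
    simp only [Finset.mem_filter, Finset.mem_univ, true_and, Fin.lt_def]
    omega

lemma Policy.lpMass_toLP {n : ℕ} (π : Policy n) (q : ℝ) (i : Fin n) :
    lpMass q (π.toLP q) (i + 1) =
      1 - ∑ j ∈ Finset.univ.filter (fun j => j < i), 1 / ((j : ℝ) + 1) *
        ((1 - q) * π.condPick q j Signal.Y + q * π.condPick q j Signal.N) := by
  rw [lpMass, sum_Ico_eq_sum_fin]
  simp only [Policy.toLP_succ, Nat.cast_add, Nat.cast_one]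

lemma Policy.toLP_feasible {n : ℕ} (π : Policy n) {q : ℝ} (h0 : 0 ≤ q) (h1 : q ≤ 1) :
    LPFeasible n q (π.toLP q) := by
  intro i hi σ
  obtain ⟨hi1, hin⟩ := Finset.mem_Icc.1 hi
  obtain ⟨k, rfl⟩ : ∃ k : Fin n, i = k + 1 := ⟨⟨i - 1, by omega⟩, by simp; omega⟩
  rw [π.toLP_succ]
  have h := π.condPick_le_survival h0 h1 k σ
  refine ⟨π.condPick_nonneg h0 h1 k σ, h.trans (π.survival_le_one h0 h1 k), ?_⟩
  have h2 := π.survival_le h0 h1 k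
  rw [← π.lpMass_toLP] at h2
  exact h.trans h2

lemma Policy.successProb_eq_lpObjective {n : ℕ} (π : Policy n) (p q : ℝ) :
    π.successProb p q = lpObjective n p (π.toLP q) := by
  rw [π.successProb_eq, lpObjective, sum_Icc_eq_sum_fin]
  simp only [Policy.toLP_succ]

/-- A threshold policy makes all the constraints of the linear program tight from its thresholds
on. -/
lemma thresholdPolicy_toLP {n tY tN : ℕ} (q : ℝ) {i : ℕ} (hi : i ∈ Finset.Icc 1 n) (σ : Signal) :
    (thresholdPolicy n tY tN).toLP q i σ =
      if thresholds tY tN σ ≤ i then lpMass q ((thresholdPolicy n tY tN).toLP q) i else 0 := by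
  classical
  obtain ⟨hi1, hin⟩ := Finset.mem_Icc.1 hi
  obtain ⟨k, rfl⟩ : ∃ k : Fin n, i = k + 1 := ⟨⟨i - 1, by omega⟩, by simp; omega⟩
  set π := thresholdPolicy n tY tN with hπ
  have hmass : lpMass q (π.toLP q) (k + 1) = π.survival q k := by
    rw [π.lpMass_toLP, π.survival_eq_one_sub]
    congr 1
    refine Finset.sum_congr rfl fun j _ => ?_
    rw [← π.nullExp_pick_BestSoFar]
    refine nullExp_congr fun r s => ?_
    split_ifs with h
    · rfl
    · simp [Policy.pickProb, hπ, thresholdPolicy, h]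
  rw [π.toLP_succ, hmass, π.survival_eq q k σ, Policy.condPick]
  split_ifs with ht
  · congr 1
    refine nullExp_congr fun r s => ?_
    split_ifs with h
    · have : π.accept k r (Function.update s k σ) = 1 := by
        simp [hπ, thresholdPolicy, h, ht]
      rw [Policy.pickProb, this, one_mul]
    · rfl
  · rw [mul_eq_zero]
    right
    refine (nullExp_congr fun r s => ?_).trans nullExp_zero
    have : π.accept k r (Function.update s k σ) = 0 := by
      simp [hπ, thresholdPolicy, ht]
    simp [Policy.pickProb, this]

/-! ### Dynamic programming for the linear program -/

/-- The gain, per unit of mass and up to the factor `1 / n`, of accepting signal `σ` at time `i`,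
when passing over is worth `i * v`. -/
def margin (p q v : ℝ) (σ : Signal) : ℝ := bestLaw p σ - noise q σ * v

/-- The gain of the optimal decision at one time. -/
noncomputable def surplus (p q v : ℝ) : ℝ :=
  max 0 (margin p q v Signal.Y) + max 0 (margin p q v Signal.N)

/-- `n` times the optimal value of the last `k` of the `n` times, per unit of mass. -/
noncomputable def valueToGo (p q : ℝ) (n : ℕ) : ℕ → ℝ
  | 0 => 0
  | k + 1 => valueToGo p q n k + surplus p q (valueToGo p q n k / ((n - k : ℕ) : ℝ))

/-- `n` times the optimal value from time `i` on (times are counted from `1`), per unit of mass. -/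
noncomputable def optValue (p q : ℝ) (n i : ℕ) : ℝ := valueToGo p q n (n + 1 - i)

section DynamicProgram

variable {p q : ℝ} {n : ℕ}

lemma optValue_end : optValue p q n (n + 1) = 0 := by
  simp [optValue, valueToGo]

lemma optValue_eq {i : ℕ} (hi : i ≤ n) :
    optValue p q n i =
      optValue p q n (i + 1) + surplus p q (optValue p q n (i + 1) / (i : ℝ)) := by
  have h1 : n + 1 - i = (n + 1 - (i + 1)) + 1 := by omega
  have h2 : n - (n + 1 - (i + 1)) = i := by omega
  rw [optValue, h1, valueToGo, h2, optValue]

lemma surplus_nonneg (v : ℝ) : 0 ≤ surplus p q v :=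
  add_nonneg (le_max_left _ _) (le_max_left _ _)

lemma margin_anti (h0 : 0 ≤ q) (h1 : q ≤ 1) (σ : Signal) {v v' : ℝ} (h : v ≤ v') :
    margin p q v' σ ≤ margin p q v σ :=
  sub_le_sub_left (mul_le_mul_of_nonneg_left h (noise_nonneg h0 h1 σ)) _

lemma surplus_anti (h0 : 0 ≤ q) (h1 : q ≤ 1) {v v' : ℝ} (h : v ≤ v') :
    surplus p q v' ≤ surplus p q v :=
  add_le_add (max_le_max le_rfl (margin_anti h0 h1 _ h)) (max_le_max le_rfl (margin_anti h0 h1 _ h))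

lemma optValue_succ_le {i : ℕ} (hi : i ≤ n) : optValue p q n (i + 1) ≤ optValue p q n i := by
  rw [optValue_eq hi]
  exact le_add_of_nonneg_right (surplus_nonneg _)

lemma optValue_nonneg {i : ℕ} (hi : i ≤ n + 1) : 0 ≤ optValue p q n i := by
  induction hi using Nat.decreasingInduction with
  | self => rw [optValue_end]
  | of_succ k hk ih => exact ih.trans (optValue_succ_le (by omega))

lemma one_le_optValue (h0 : 0 ≤ p) (h1 : p ≤ 1) {i : ℕ} (hi : i ≤ n) : 1 ≤ optValue p q n i := by
  induction hi using Nat.decreasingInduction with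
  | self =>
    rw [optValue_eq le_rfl, optValue_end]
    simp [surplus, margin, bestLaw, max_eq_right h0, max_eq_right (sub_nonneg.2 h1)]
  | of_succ k hk ih => exact ih.trans (optValue_succ_le hk.le)

/-- What a point `z` of the linear program loses at time `i` to the optimal decisions. -/
noncomputable def loss (p q : ℝ) (n : ℕ) (z : ℕ → Signal → ℝ) (i : ℕ) : ℝ :=
  ∑ σ, (lpMass q z i * max 0 (margin p q (optValue p q n (i + 1) / (i : ℝ)) σ) -
    z i σ * margin p q (optValue p q n (i + 1) / (i : ℝ)) σ)

lemma lpMass_succ (z : ℕ → Signal → ℝ) {i : ℕ} (hi : 1 ≤ i) :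
    lpMass q z (i + 1) =
      lpMass q z i - 1 / (i : ℝ) * ((1 - q) * z i Signal.Y + q * z i Signal.N) := by
  rw [lpMass, lpMass, Finset.sum_Ico_succ_top hi]
  ring

lemma lpMass_one (z : ℕ → Signal → ℝ) : lpMass q z 1 = 1 := by
  simp [lpMass]

lemma partial_objective_eq (z : ℕ → Signal → ℝ) {k : ℕ} (hk : 1 ≤ k) (hkn : k ≤ n + 1) :
    ∑ i ∈ Finset.Ico 1 k, (p * z i Signal.Y + (1 - p) * z i Signal.N) +
        lpMass q z k * optValue p q n k =
      optValue p q n 1 - ∑ i ∈ Finset.Ico 1 k, loss p q n z i := by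
  induction k, hk using Nat.le_induction with
  | base => simp [lpMass_one]
  | succ k hk ih =>
    have ih := ih (by omega)
    rw [Finset.sum_Ico_succ_top hk, Finset.sum_Ico_succ_top hk, lpMass_succ z hk]
    rw [optValue_eq (show k ≤ n by omega)] at ih
    have hl : loss p q n z k = _ := sum_signal _
    rw [surplus] at ih
    simp only [margin, bestLaw, noise] at hl ih
    linear_combination ih + hl

/-- The objective falls short of the value of the dynamic program by the sum of the losses. -/
lemma lpObjective_eq (hn : 1 ≤ n) (z : ℕ → Signal → ℝ) :
    lpObjective n p z =
      1 / (n : ℝ) * (optValue p q n 1 - ∑ i ∈ Finset.Icc 1 n, loss p q n z i) := by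
  have h := partial_objective_eq (p := p) (q := q) (n := n) z (k := n + 1) (by omega) le_rfl
  rw [optValue_end, mul_zero, add_zero] at h
  rw [lpObjective, ← Finset.mul_sum]
  congr 1

lemma loss_nonneg {z : ℕ → Signal → ℝ} (hz : LPFeasible n q z) {i : ℕ}
    (hi : i ∈ Finset.Icc 1 n) : 0 ≤ loss p q n z i := by
  refine Finset.sum_nonneg fun σ _ => sub_nonneg.2 ?_
  obtain ⟨h0, -, h2⟩ := hz i hi σ
  exact (mul_le_mul_of_nonneg_left (le_max_right 0 _) h0).trans
    (mul_le_mul_of_nonneg_right h2 (le_max_left _ _))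

lemma lpObjective_le (hn : 1 ≤ n) {z : ℕ → Signal → ℝ} (hz : LPFeasible n q z) :
    lpObjective n p z ≤ 1 / (n : ℝ) * optValue p q n 1 := by
  rw [lpObjective_eq (q := q) hn]
  refine mul_le_mul_of_nonneg_left ?_ (by positivity)
  exact sub_le_self _ (Finset.sum_nonneg fun i hi => loss_nonneg hz hi)

lemma Policy.successProb_le (π : Policy n) (hn : 1 ≤ n) (h0 : 0 ≤ q) (h1 : q ≤ 1) :
    π.successProb p q ≤ 1 / (n : ℝ) * optValue p q n 1 := by
  rw [π.successProb_eq_lpObjective]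
  exact lpObjective_le hn (π.toLP_feasible h0 h1)

lemma loss_threshold {tY tN i : ℕ} (hi : i ∈ Finset.Icc 1 n) :
    loss p q n ((thresholdPolicy n tY tN).toLP q) i =
      lpMass q ((thresholdPolicy n tY tN).toLP q) i *
        ∑ σ, (max 0 (margin p q (optValue p q n (i + 1) / (i : ℝ)) σ) -
          if thresholds tY tN σ ≤ i then margin p q (optValue p q n (i + 1) / (i : ℝ)) σ
          else 0) := by
  rw [loss, Finset.mul_sum]
  refine Finset.sum_congr rfl fun σ _ => ?_
  rw [thresholdPolicy_toLP q hi]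
  split_ifs <;> ring

lemma thresholdPolicy_successProb_of_margin {tY tN : ℕ} (hn : 1 ≤ n)
    (h : ∀ i ∈ Finset.Icc 1 n, ∀ σ,
      (thresholds tY tN σ ≤ i → 0 ≤ margin p q (optValue p q n (i + 1) / (i : ℝ)) σ) ∧
      (i < thresholds tY tN σ → margin p q (optValue p q n (i + 1) / (i : ℝ)) σ ≤ 0)) :
    (thresholdPolicy n tY tN).successProb p q = 1 / (n : ℝ) * optValue p q n 1 := by
  rw [Policy.successProb_eq_lpObjective, lpObjective_eq (q := q) hn]
  rw [Finset.sum_eq_zero, sub_zero]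
  intro i hi
  rw [loss_threshold hi, Finset.sum_eq_zero, mul_zero]
  intro σ _
  obtain ⟨h1, h2⟩ := h i hi σ
  split_ifs with ht
  · rw [max_eq_right (h1 ht), sub_self]
  · rw [max_eq_left (h2 (not_le.1 ht)), sub_zero]

lemma continuation_anti {i j : ℕ} (hi : 1 ≤ i) (hij : i ≤ j) (hj : j ≤ n) :
    optValue p q n (j + 1) / (j : ℝ) ≤ optValue p q n (i + 1) / (i : ℝ) := by
  induction j, hij using Nat.le_induction with
  | base => exact le_rfl
  | succ j hij ih =>
    refine le_trans ?_ (ih (by omega))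
    have hj0 : (0 : ℝ) < j := by exact_mod_cast (by omega : 0 < j)
    refine div_le_div₀ (optValue_nonneg (by omega)) (optValue_succ_le hj) hj0 ?_
    push_cast
    linarith

/-- The margins grow with time, hence change sign at thresholds; the one for `Y` comes first
because `1 - q ≤ q` and `1 - p ≤ p`. -/
lemma exists_thresholds (hp : p ∈ Set.Icc (1 / 2 : ℝ) 1) (hq : q ∈ Set.Icc (1 / 2 : ℝ) 1)
    (hn : 1 ≤ n) :
    ∃ tY tN : ℕ, 1 ≤ tY ∧ tY ≤ tN ∧ tN ≤ n ∧ ∀ i ∈ Finset.Icc 1 n, ∀ σ,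
      (thresholds tY tN σ ≤ i → 0 ≤ margin p q (optValue p q n (i + 1) / (i : ℝ)) σ) ∧
      (i < thresholds tY tN σ → margin p q (optValue p q n (i + 1) / (i : ℝ)) σ ≤ 0) := by
  classical
  obtain ⟨hp0, hp1⟩ := hp
  obtain ⟨hq0, hq1⟩ := hq
  have hq0' : 0 ≤ q := by linarith
  have hlast : ∀ σ, 1 ≤ n ∧ 0 ≤ margin p q (optValue p q n (n + 1) / (n : ℝ)) σ := by
    refine fun σ => ⟨hn, ?_⟩
    rw [optValue_end]
    cases σ <;> simp [margin, bestLaw] <;> linarith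
  have hex : ∀ σ, ∃ i : ℕ, 1 ≤ i ∧ 0 ≤ margin p q (optValue p q n (i + 1) / (i : ℝ)) σ :=
    fun σ => ⟨n, hlast σ⟩
  have hle : ∀ σ, Nat.find (hex σ) ≤ n := fun σ => Nat.find_min' _ (hlast σ)
  refine ⟨Nat.find (hex Signal.Y), Nat.find (hex Signal.N), (Nat.find_spec (hex _)).1, ?_,
    hle _, ?_⟩
  · refine Nat.find_min' _ ⟨(Nat.find_spec (hex Signal.N)).1, ?_⟩
    have h := (Nat.find_spec (hex Signal.N)).2
    have hv : 0 ≤ optValue p q n (Nat.find (hex Signal.N) + 1) / (Nat.find (hex Signal.N) : ℝ) :=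
      div_nonneg (optValue_nonneg (by have := hle Signal.N; omega)) (by positivity)
    generalize optValue p q n (Nat.find (hex Signal.N) + 1) / (Nat.find (hex Signal.N) : ℝ) = v
      at h hv ⊢
    simp only [margin, bestLaw, noise] at h ⊢
    nlinarith
  · intro i hi σ
    have ht : thresholds (Nat.find (hex Signal.Y)) (Nat.find (hex Signal.N)) σ =
        Nat.find (hex σ) := by cases σ <;> rfl
    rw [ht]
    obtain ⟨hi1, hin⟩ := Finset.mem_Icc.1 hi
    refine ⟨fun h => ?_, fun h => ?_⟩
    · obtain ⟨ht1, ht2⟩ := Nat.find_spec (hex σ)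
      exact ht2.trans (margin_anti hq0' hq1 σ (continuation_anti ht1 h hin))
    · have := Nat.find_min (hex σ) h
      push Not at this
      exact (this hi1).le

lemma optN_eq (hp : p ∈ Set.Icc (1 / 2 : ℝ) 1) (hq : q ∈ Set.Icc (1 / 2 : ℝ) 1) (hn : 1 ≤ n) :
    optN n p q = 1 / (n : ℝ) * optValue p q n 1 := by
  obtain ⟨tY, tN, -, -, -, h⟩ := exists_thresholds hp hq hn
  have hq0 : 0 ≤ q := by linarith [hq.1]
  refine IsGreatest.csSup_eq ⟨⟨(thresholdPolicy n tY tN).toLP q, Policy.toLP_feasible _ hq0 hq.2,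
    ?_⟩, ?_⟩
  · rw [← Policy.successProb_eq_lpObjective, thresholdPolicy_successProb_of_margin hn h]
  · rintro v ⟨z, hz, rfl⟩
    exact lpObjective_le hn hz

lemma lpMass_threshold_pos {tY tN i : ℕ} (hq0 : 0 < q) (hq1 : q ≤ 1) (htN : tN ≤ n) (hi : 1 ≤ i)
    (hiN : i ≤ tN) : 0 < lpMass q ((thresholdPolicy n tY tN).toLP q) i := by
  induction i, hi using Nat.le_induction with
  | base => rw [lpMass_one]; exact one_pos
  | succ i hi ih =>
    have ih := ih (by omega)
    have hmem : i ∈ Finset.Icc 1 n := Finset.mem_Icc.2 ⟨hi, by omega⟩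
    rw [lpMass_succ _ hi, thresholdPolicy_toLP q hmem Signal.N,
      thresholdPolicy_toLP q hmem Signal.Y, if_neg (show ¬ thresholds tY tN Signal.N ≤ i by
        simp only [thresholds]; omega)]
    have hi' : 1 / (i : ℝ) ≤ 1 := by
      rw [div_le_one (by positivity)]
      exact_mod_cast hi
    have hi0 : 0 ≤ 1 / (i : ℝ) := by positivity
    split_ifs
    · have : 1 / (i : ℝ) * (1 - q) ≤ 1 - q := mul_le_of_le_one_left (by linarith) hi'
      nlinarith
    · simpa using ih

/-- Up to the threshold for `N` every time is reached with positive probability, so a wrong decision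
there would cost an optimal threshold policy something. -/
lemma margin_of_isOptimal {tY tN : ℕ} (hp : p ∈ Set.Icc (1 / 2 : ℝ) 1)
    (hq : q ∈ Set.Icc (1 / 2 : ℝ) 1) (hn : 1 ≤ n) (htN : tN ≤ n)
    (hopt : (thresholdPolicy n tY tN).IsOptimal p q) {i : ℕ} (hi : 1 ≤ i) (hiN : i ≤ tN)
    (σ : Signal) :
    (thresholds tY tN σ ≤ i → 0 ≤ margin p q (optValue p q n (i + 1) / (i : ℝ)) σ) ∧
      (i < thresholds tY tN σ → margin p q (optValue p q n (i + 1) / (i : ℝ)) σ ≤ 0) := by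
  have hq0 : 0 ≤ q := by linarith [hq.1]
  set π := thresholdPolicy n tY tN with hπ
  have hfeas := π.toLP_feasible hq0 hq.2
  have hsum : ∑ i ∈ Finset.Icc 1 n, loss p q n (π.toLP q) i = 0 := by
    refine le_antisymm ?_ (Finset.sum_nonneg fun i hi => loss_nonneg hfeas hi)
    obtain ⟨sY, sN, -, -, -, h⟩ := exists_thresholds hp hq hn
    have h1 := hopt (thresholdPolicy n sY sN)
    rw [thresholdPolicy_successProb_of_margin hn h, π.successProb_eq_lpObjective,
      lpObjective_eq (q := q) hn] at h1
    have h2 := le_of_mul_le_mul_left h1 (by positivity)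
    linarith
  have hmem : i ∈ Finset.Icc 1 n := Finset.mem_Icc.2 ⟨hi, by omega⟩
  have hloss := (Finset.sum_eq_zero_iff_of_nonneg fun i hi => loss_nonneg hfeas hi).1 hsum i hmem
  rw [loss_threshold hmem, mul_eq_zero] at hloss
  have hpos := lpMass_threshold_pos (tY := tY) (by linarith [hq.1]) hq.2 htN hi hiN
  have hloss := hloss.resolve_left hpos.ne'
  rw [Finset.sum_eq_zero_iff_of_nonneg] at hloss
  · have := hloss σ (Finset.mem_univ _)
    refine ⟨fun h => ?_, fun h => ?_⟩
    · rw [if_pos h, sub_eq_zero] at this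
      exact max_eq_right_iff.1 this
    · rw [if_neg (not_le.2 h), sub_zero] at this
      exact max_eq_left_iff.1 this
  · intro σ _
    split_ifs
    · exact sub_nonneg.2 (le_max_right _ _)
    · simp

end DynamicProgram

/-! ### The limiting value function -/

/-- `φ` is minus a slope of `w` at each point of `[a, b]`: the line through `(x, w x)` with slope
`-φ x` lies above `w`. In particular `w` is concave on `[a, b]`. -/
def IsTangent (w φ : ℝ → ℝ) (a b : ℝ) : Prop :=
  ∀ x ∈ Set.Icc a b, ∀ y ∈ Set.Icc a b, w y ≤ w x + (x - y) * φ x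

lemma IsTangent.mono_slope {w φ : ℝ → ℝ} {a b : ℝ} (h : IsTangent w φ a b) {x y : ℝ}
    (hx : x ∈ Set.Icc a b) (hy : y ∈ Set.Icc a b) (hxy : x ≤ y) : φ x ≤ φ y := by
  rcases hxy.eq_or_lt with rfl | hlt
  · exact le_rfl
  · have h1 := h x hx y hy
    have h2 := h y hy x hx
    have : (y - x) * φ x ≤ (y - x) * φ y := by linarith
    exact le_of_mul_le_mul_left this (sub_pos.2 hlt)

lemma IsTangent.glue {w φ : ℝ → ℝ} {a b c : ℝ} (hab : a ≤ b) (hbc : b ≤ c)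
    (h1 : IsTangent w φ a b) (h2 : IsTangent w φ b c) : IsTangent w φ a c := by
  have hb1 : b ∈ Set.Icc a b := ⟨hab, le_rfl⟩
  have hb2 : b ∈ Set.Icc b c := ⟨le_rfl, hbc⟩
  intro x hx y hy
  rcases le_total x b with hxb | hbx <;> rcases le_total y b with hyb | hby
  · exact h1 x ⟨hx.1, hxb⟩ y ⟨hy.1, hyb⟩
  · have e1 := h1 x ⟨hx.1, hxb⟩ b hb1
    have e2 := h2 b hb2 y ⟨hby, hy.2⟩
    have e3 := mul_le_mul_of_nonneg_left (h1.mono_slope ⟨hx.1, hxb⟩ hb1 hxb) (sub_nonneg.2 hby)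
    linarith
  · have e1 := h2 x ⟨hbx, hx.2⟩ b hb2
    have e2 := h1 b hb1 y ⟨hy.1, hyb⟩
    have e3 := mul_le_mul_of_nonneg_left (h2.mono_slope hb2 ⟨hbx, hx.2⟩ hbx) (sub_nonneg.2 hyb)
    linarith
  · exact h2 x ⟨hbx, hx.2⟩ y ⟨hby, hy.2⟩

lemma IsTangent.congr {w φ w' φ' : ℝ → ℝ} {a b : ℝ} (h : IsTangent w φ a b)
    (hw : ∀ x ∈ Set.Icc a b, w' x = w x) (hφ : ∀ x ∈ Set.Icc a b, φ' x = φ x) :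
    IsTangent w' φ' a b := by
  intro x hx y hy
  rw [hw x hx, hw y hy, hφ x hx]
  exact h x hx y hy

/-- The limit of the relative threshold for `N`. -/
noncomputable def limitN (p q : ℝ) : ℝ := Real.exp (p / q - 1 / q)

/-- The limit of the relative threshold for `Y`. -/
noncomputable def limitY (p q : ℝ) : ℝ := ((1 - q) / p) ^ (1 / q) * limitN p q

/-- The limit of the optimal success probability. -/
noncomputable def limitOpt (p q : ℝ) : ℝ := ((1 - q) / p) ^ ((1 - q) / q) * limitN p q

/-- The limit of `optValue p q n i / n` as `i / n` tends to `x`. It solves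
`-w' = surplus (w / x)` with `w 1 = 0`. -/
noncomputable def limitValue (p q x : ℝ) : ℝ :=
  if x < limitY p q then limitOpt p q
  else if x < limitN p q then (limitN p q ^ q * x ^ (1 - q) - p * x) / q
  else -(x * Real.log x)

/-- Minus the derivative of `limitValue`. -/
noncomputable def limitSlope (p q x : ℝ) : ℝ :=
  if x < limitY p q then 0
  else if x < limitN p q then (p - (1 - q) * (limitN p q / x) ^ q) / q
  else 1 + Real.log x

/-- The tangent inequality for the concave function `y ↦ y ^ (1 - q)`. At `x = 0` it needs `q = 1`,
and then says `1 ≤ 1` because `0 ^ 0 = 1`. -/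
lemma rpow_one_sub_le {q θ x y : ℝ} (hq0 : 0 < q) (hq1 : q ≤ 1) (hθ : 0 ≤ θ)
    (hxq : 0 < x ∨ q = 1) (hy : 0 ≤ y) :
    θ ^ q * y ^ (1 - q) ≤ θ ^ q * x ^ (1 - q) + (y - x) * ((1 - q) * (θ / x) ^ q) := by
  rcases hxq with hx | rfl
  · have hb := rpow_one_add_le_one_add_mul_self (s := y / x - 1) (p := 1 - q)
      (by have := div_nonneg hy hx.le; linarith) (by linarith) (by linarith)
    rw [add_sub_cancel, Real.div_rpow hy hx.le] at hb
    have hx1 : 0 < x ^ (1 - q) := Real.rpow_pos_of_pos hx _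
    have hxx : x ^ (1 - q) = x / x ^ q := by rw [Real.rpow_sub hx, Real.rpow_one]
    have hxq : 0 < x ^ q := Real.rpow_pos_of_pos hx _
    rw [div_le_iff₀ hx1] at hb
    have := mul_le_mul_of_nonneg_left hb (Real.rpow_nonneg hθ q)
    refine this.trans (le_of_eq ?_)
    rw [Real.div_rpow hθ hx.le, hxx]
    field_simp
  · simp

lemma isTangent_neg_mul_log {a b : ℝ} (ha : 0 < a) :
    IsTangent (fun x => -(x * Real.log x)) (fun x => 1 + Real.log x) a b := by
  intro x hx y hy
  have hx0 : 0 < x := ha.trans_le hx.1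
  have hy0 : 0 < y := ha.trans_le hy.1
  have h := Real.log_le_sub_one_of_pos (div_pos hx0 hy0)
  rw [Real.log_div hx0.ne' hy0.ne'] at h
  have h2 := mul_le_mul_of_nonneg_left h hy0.le
  have h3 : y * (x / y - 1) = x - y := by field_simp
  simp only
  linarith

section Limit

variable {p q : ℝ}

lemma limitN_pos : 0 < limitN p q := Real.exp_pos _

lemma log_limitN : Real.log (limitN p q) = p / q - 1 / q := Real.log_exp _

lemma limitN_le_one (hp1 : p ≤ 1) (hq0 : 0 < q) : limitN p q ≤ 1 := by
  rw [limitN, Real.exp_le_one_iff, ← sub_div]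
  exact div_nonpos_of_nonpos_of_nonneg (by linarith) hq0.le

lemma limitY_nonneg (hp0 : 0 < p) (hq1 : q ≤ 1) : 0 ≤ limitY p q :=
  mul_nonneg (Real.rpow_nonneg (div_nonneg (by linarith) hp0.le) _) limitN_pos.le

lemma limitY_le_limitN (hp0 : 0 < p) (hq0 : 0 < q) (hq1 : q ≤ 1) (hpq : 1 - q ≤ p) :
    limitY p q ≤ limitN p q := by
  refine mul_le_of_le_one_left limitN_pos.le (Real.rpow_le_one
    (div_nonneg (by linarith) hp0.le) ?_ (by positivity))
  rwa [div_le_one hp0]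

lemma limitY_pos_or (hp0 : 0 < p) (hq1 : q ≤ 1) : 0 < limitY p q ∨ q = 1 := by
  rcases hq1.eq_or_lt with h | h
  · exact Or.inr h
  · exact Or.inl (mul_pos (Real.rpow_pos_of_pos (div_pos (by linarith) hp0) _) limitN_pos)

/-- At `limitY` the signal `Y` is accepted and passed over with equal profit. -/
lemma one_sub_mul_limitOpt (hp0 : 0 < p) (hq0 : 0 < q) (hq1 : q ≤ 1) :
    (1 - q) * limitOpt p q = p * limitY p q := by
  have ha : 0 ≤ (1 - q) / p := div_nonneg (by linarith) hp0.le
  have h : ((1 - q) / p) ^ (1 / q) = (1 - q) / p * ((1 - q) / p) ^ ((1 - q) / q) := by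
    have e : 1 / q = 1 + (1 - q) / q := by field_simp; ring
    rw [e, Real.rpow_add' ha (by rw [← e]; positivity), Real.rpow_one]
  rw [limitOpt, limitY, h]
  field_simp

lemma middle_limitY (hp0 : 0 < p) (hq0 : 0 < q) (hq1 : q ≤ 1) :
    (limitN p q ^ q * limitY p q ^ (1 - q) - p * limitY p q) / q = limitOpt p q := by
  have ha : 0 ≤ (1 - q) / p := div_nonneg (by linarith) hp0.le
  rw [← one_sub_mul_limitOpt hp0 hq0 hq1]
  have h : limitN p q ^ q * limitY p q ^ (1 - q) = limitOpt p q := by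
    rw [limitY, Real.mul_rpow (Real.rpow_nonneg ha _) limitN_pos.le, ← Real.rpow_mul ha,
      mul_left_comm, ← Real.rpow_add limitN_pos, limitOpt]
    simp
    left
    congr 1
    field_simp
  rw [h]
  field_simp
  ring

lemma limitN_div_limitY_rpow (hp0 : 0 < p) (hq0 : 0 < q) (hq1 : q < 1) :
    (limitN p q / limitY p q) ^ q = p / (1 - q) := by
  have ha : 0 < (1 - q) / p := div_pos (by linarith) hp0
  have hθ := (limitN_pos (p := p) (q := q)).ne'
  have h : limitN p q / limitY p q = (((1 - q) / p) ^ (1 / q))⁻¹ := by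
    rw [limitY]
    field_simp
  rw [h, Real.inv_rpow (Real.rpow_nonneg ha.le _), ← Real.rpow_mul ha.le,
    one_div_mul_cancel hq0.ne', Real.rpow_one, inv_div]

lemma middle_limitN (hq0 : 0 < q) :
    (limitN p q ^ q * limitN p q ^ (1 - q) - p * limitN p q) / q =
      -(limitN p q * Real.log (limitN p q)) := by
  rw [← Real.rpow_add limitN_pos, log_limitN]
  simp
  field_simp
  ring

lemma limitValue_of_le_limitY (hp0 : 0 < p) (hq0 : 0 < q) (hq1 : q ≤ 1) (hpq : 1 - q ≤ p) {x : ℝ}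
    (hx : x ≤ limitY p q) : limitValue p q x = limitOpt p q := by
  rcases hx.lt_or_eq with h | rfl
  · simp [limitValue, h]
  · rw [limitValue, if_neg (lt_irrefl _)]
    split_ifs with h
    · exact middle_limitY hp0 hq0 hq1
    · have := le_antisymm (limitY_le_limitN hp0 hq0 hq1 hpq) (not_lt.1 h)
      rw [← middle_limitY hp0 hq0 hq1, this, middle_limitN hq0]

lemma limitValue_middle (hq0 : 0 < q) {x : ℝ} (hx : limitY p q ≤ x) (hxN : x ≤ limitN p q) :
    limitValue p q x = (limitN p q ^ q * x ^ (1 - q) - p * x) / q := by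
  rw [limitValue, if_neg (not_lt.2 hx)]
  split_ifs with h
  · rfl
  · rw [le_antisymm hxN (not_lt.1 h), middle_limitN hq0]

lemma limitValue_of_limitN_le (hp0 : 0 < p) (hq0 : 0 < q) (hq1 : q ≤ 1) (hpq : 1 - q ≤ p) {x : ℝ}
    (hx : limitN p q ≤ x) : limitValue p q x = -(x * Real.log x) := by
  rw [limitValue, if_neg (not_lt.2 ((limitY_le_limitN hp0 hq0 hq1 hpq).trans hx)),
    if_neg (not_lt.2 hx)]

lemma limitSlope_middle (hq0 : 0 < q) {x : ℝ} (hx : limitY p q ≤ x) (hxN : x ≤ limitN p q) :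
    limitSlope p q x = (p - (1 - q) * (limitN p q / x) ^ q) / q := by
  rw [limitSlope, if_neg (not_lt.2 hx)]
  split_ifs with h
  · rfl
  · rw [le_antisymm hxN (not_lt.1 h), log_limitN, div_self limitN_pos.ne', Real.one_rpow]
    field_simp
    ring

lemma limitSlope_of_limitN_le (hp0 : 0 < p) (hq0 : 0 < q) (hq1 : q ≤ 1) (hpq : 1 - q ≤ p) {x : ℝ}
    (hx : limitN p q ≤ x) : limitSlope p q x = 1 + Real.log x := by
  rw [limitSlope, if_neg (not_lt.2 ((limitY_le_limitN hp0 hq0 hq1 hpq).trans hx)),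
    if_neg (not_lt.2 hx)]

lemma limitSlope_of_le_limitY (hp0 : 0 < p) (hq0 : 0 < q) (hq1 : q ≤ 1) (hpq : 1 - q ≤ p) {x : ℝ}
    (hx0 : 0 < x) (hx : x ≤ limitY p q) : limitSlope p q x = 0 := by
  rcases hx.lt_or_eq with h | rfl
  · simp [limitSlope, h]
  · rw [limitSlope_middle hq0 le_rfl (limitY_le_limitN hp0 hq0 hq1 hpq)]
    have hq1' : q < 1 := by
      refine lt_of_le_of_ne hq1 fun h => ?_
      subst h
      simp [limitY] at hx0
    rw [limitN_div_limitY_rpow hp0 hq0 hq1']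
    have : 1 - q ≠ 0 := by linarith
    field_simp
    ring

lemma isTangent_limitValue (hp0 : 0 < p) (hp1 : p ≤ 1) (hq0 : 0 < q) (hq1 : q ≤ 1)
    (hpq : 1 - q ≤ p) : IsTangent (limitValue p q) (limitSlope p q) 0 1 := by
  have hYN := limitY_le_limitN hp0 hq0 hq1 hpq
  have hY0 := limitY_nonneg hp0 hq1
  have t1 : IsTangent (limitValue p q) (limitSlope p q) 0 (limitY p q) := by
    intro x hx y hy
    rw [limitValue_of_le_limitY hp0 hq0 hq1 hpq hx.2, limitValue_of_le_limitY hp0 hq0 hq1 hpq hy.2]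
    rcases hx.1.eq_or_lt with h | h
    · subst h
      rcases hx.2.eq_or_lt with h' | h'
      · rw [← h'] at hy
        simp [le_antisymm hy.2 hy.1]
      · simp [limitSlope, h']
    · simp [limitSlope_of_le_limitY hp0 hq0 hq1 hpq h hx.2]
  have t2 : IsTangent (limitValue p q) (limitSlope p q) (limitY p q) (limitN p q) := by
    intro x hx y hy
    rw [limitValue_middle hq0 hx.1 hx.2, limitValue_middle hq0 hy.1 hy.2,
      limitSlope_middle hq0 hx.1 hx.2]
    have := rpow_one_sub_le hq0 hq1 (limitN_pos (p := p) (q := q)).le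
      ((limitY_pos_or hp0 hq1).imp_left fun h => h.trans_le hx.1) (hY0.trans hy.1)
    rw [← mul_div_assoc, ← add_div]
    gcongr
    linarith
  have t3 : IsTangent (limitValue p q) (limitSlope p q) (limitN p q) 1 :=
    (isTangent_neg_mul_log limitN_pos).congr
      (fun x hx => limitValue_of_limitN_le hp0 hq0 hq1 hpq hx.1)
      (fun x hx => limitSlope_of_limitN_le hp0 hq0 hq1 hpq hx.1)
  exact (t1.glue hY0 hYN t2).glue (hY0.trans hYN) (limitN_le_one hp1 hq0) t3

/-- The differential equation `-w' = surplus (w / x)` for the limiting value `w`. -/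
lemma limitSlope_eq_surplus (hp : p ∈ Set.Icc (1 / 2 : ℝ) 1) (hq : q ∈ Set.Icc (1 / 2 : ℝ) 1)
    {x : ℝ} (hx0 : 0 < x) (hx1 : x ≤ 1) :
    surplus p q (limitValue p q x / x) = limitSlope p q x := by
  obtain ⟨hp2, hp1⟩ := hp
  obtain ⟨hq2, hq1⟩ := hq
  have hp0 : 0 < p := by linarith
  have hq0 : 0 < q := by linarith
  have hpq : 1 - q ≤ p := by linarith
  have hYN := limitY_le_limitN hp0 hq0 hq1 hpq
  simp only [surplus, margin, bestLaw, noise]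
  rcases le_total x (limitY p q) with hY | hY
  · rw [limitValue_of_le_limitY hp0 hq0 hq1 hpq hY, limitSlope_of_le_limitY hp0 hq0 hq1 hpq hx0 hY]
    have hv : p ≤ (1 - q) * (limitOpt p q / x) := by
      rw [← mul_div_assoc, one_sub_mul_limitOpt hp0 hq0 hq1, le_div_iff₀ hx0]
      exact mul_le_mul_of_nonneg_left hY hp0.le
    have hL : 0 ≤ limitOpt p q / x :=
      div_nonneg (mul_nonneg (Real.rpow_nonneg (div_nonneg (by linarith) hp0.le) _)
        limitN_pos.le) hx0.le
    rw [max_eq_left (by linarith), max_eq_left (by nlinarith), add_zero]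
  · rcases le_total x (limitN p q) with hN | hN
    · rw [limitValue_middle hq0 hY hN, limitSlope_middle hq0 hY hN]
      have hv : (limitN p q ^ q * x ^ (1 - q) - p * x) / q / x =
          ((limitN p q / x) ^ q - p) / q := by
        have : 0 < x ^ q := Real.rpow_pos_of_pos hx0 q
        rw [Real.div_rpow limitN_pos.le hx0.le, Real.rpow_sub hx0, Real.rpow_one]
        field_simp
      rw [hv]
      have h1 : 1 ≤ (limitN p q / x) ^ q :=
        Real.one_le_rpow ((one_le_div hx0).2 hN) hq0.le
      have h2 : (1 - q) * (limitN p q / x) ^ q ≤ p := by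
        rcases limitY_pos_or hp0 hq1 with hYp | rfl
        · rcases hq1.eq_or_lt with rfl | hq1
          · simpa using hp0.le
          · have hle : (limitN p q / x) ^ q ≤ p / (1 - q) := by
              rw [← limitN_div_limitY_rpow hp0 hq0 hq1]
              exact Real.rpow_le_rpow (div_nonneg limitN_pos.le hx0.le)
                (div_le_div_of_nonneg_left limitN_pos.le hYp hY) hq0.le
            rw [le_div_iff₀ (by linarith)] at hle
            linarith
        · simpa using hp0.le
      have e1 : p - (1 - q) * (((limitN p q / x) ^ q - p) / q) =
          (p - (1 - q) * (limitN p q / x) ^ q) / q := by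
        field_simp
        ring
      have e2 : 1 - p - q * (((limitN p q / x) ^ q - p) / q) = 1 - (limitN p q / x) ^ q := by
        field_simp
        ring
      rw [e1, e2, max_eq_right (div_nonneg (by linarith) hq0.le), max_eq_left (by linarith),
        add_zero]
    · rw [limitValue_of_limitN_le hp0 hq0 hq1 hpq hN, limitSlope_of_limitN_le hp0 hq0 hq1 hpq hN]
      have hv : -(x * Real.log x) / x = -Real.log x := by field_simp
      rw [hv]
      have h1 : Real.log x ≤ 0 := Real.log_nonpos hx0.le hx1
      have h2 : p - 1 ≤ q * Real.log x := by
        have h := Real.log_le_log limitN_pos hN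
        rw [log_limitN, ← sub_div, div_le_iff₀ hq0] at h
        linarith
      rw [max_eq_right (by nlinarith), max_eq_right (by linarith)]
      ring

lemma limitSlope_nonneg (hp : p ∈ Set.Icc (1 / 2 : ℝ) 1) (hq : q ∈ Set.Icc (1 / 2 : ℝ) 1)
    {x : ℝ} (hx0 : 0 ≤ x) (hx1 : x ≤ 1) : 0 ≤ limitSlope p q x := by
  rcases hx0.eq_or_lt with rfl | hx0
  · have hp0 : 0 < p := by linarith [hp.1]
    rcases limitY_pos_or hp0 hq.2 with h | rfl
    · simp [limitSlope, h]
    · simp [limitSlope, limitY, limitN_pos, hp0.le]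
  · rw [← limitSlope_eq_surplus hp hq hx0 hx1]
    exact surplus_nonneg _

lemma limitValue_anti (hp : p ∈ Set.Icc (1 / 2 : ℝ) 1) (hq : q ∈ Set.Icc (1 / 2 : ℝ) 1)
    {x y : ℝ} (hx0 : 0 ≤ x) (hxy : x ≤ y) (hy1 : y ≤ 1) : limitValue p q y ≤ limitValue p q x := by
  have h := isTangent_limitValue (p := p) (q := q) (by linarith [hp.1]) hp.2 (by linarith [hq.1])
    hq.2 (by linarith [hp.1, hq.1]) x ⟨hx0, hxy.trans hy1⟩ y ⟨hx0.trans hxy, hy1⟩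
  nlinarith [limitSlope_nonneg hp hq hx0 (hxy.trans hy1)]

end Limit

/-! ### Comparison of the dynamic program with its limit -/

section Comparison

variable {p q : ℝ} {n : ℕ}

/-- One step of the dynamic program is monotone in the value of the next time. -/
lemma add_surplus_mono (hq0 : 0 ≤ q) (hq1 : q ≤ 1) {i : ℕ} (hi : 1 ≤ i) {u v : ℝ} (h : u ≤ v) :
    u + surplus p q (u / (i : ℝ)) ≤ v + surplus p q (v / (i : ℝ)) := by
  have hi' : (1 : ℝ) ≤ i := by exact_mod_cast hi
  have hd : v / (i : ℝ) - u / (i : ℝ) ≤ v - u := by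
    rw [← sub_div]
    exact div_le_self (sub_nonneg.2 h) hi'
  have hm : u / (i : ℝ) ≤ v / (i : ℝ) := by gcongr
  have key : ∀ σ, max 0 (margin p q (u / (i : ℝ)) σ) ≤
      max 0 (margin p q (v / (i : ℝ)) σ) + noise q σ * (v / (i : ℝ) - u / (i : ℝ)) := by
    intro σ
    have h2 := mul_nonneg (noise_nonneg hq0 hq1 σ) (sub_nonneg.2 hm)
    refine max_le (add_nonneg (le_max_left _ _) h2) ?_
    have h3 : margin p q (u / (i : ℝ)) σ =
        margin p q (v / (i : ℝ)) σ + noise q σ * (v / (i : ℝ) - u / (i : ℝ)) := by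
      simp only [margin]
      ring
    rw [h3]
    linarith [le_max_right 0 (margin p q (v / (i : ℝ)) σ)]
  have hY := key Signal.Y
  have hN := key Signal.N
  simp only [surplus, noise] at *
  linarith

/-- The dynamic program lies above its limit, by at most `1` altogether: the local errors are
increments of the slope of the limit and telescope. -/
lemma optValue_bounds (hp : p ∈ Set.Icc (1 / 2 : ℝ) 1) (hq : q ∈ Set.Icc (1 / 2 : ℝ) 1)
    (hn : 1 ≤ n) {i : ℕ} (hi : i ≤ n) :
    n * limitValue p q ((i : ℝ) / n) ≤ optValue p q n (i + 1) ∧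
      optValue p q n (i + 1) ≤
        n * limitValue p q ((i : ℝ) / n) + 1 - limitSlope p q ((i : ℝ) / n) := by
  have hn0 : (0 : ℝ) < n := by exact_mod_cast hn
  have hp0 : 0 < p := by linarith [hp.1]
  have hq0 : 0 < q := by linarith [hq.1]
  have hpq : 1 - q ≤ p := by linarith [hp.1, hq.1]
  induction hi using Nat.decreasingInduction with
  | self =>
    have h1 := limitN_le_one hp.2 hq0
    rw [div_self hn0.ne', optValue_end, limitValue_of_limitN_le hp0 hq0 hq.2 hpq h1,
      limitSlope_of_limitN_le hp0 hq0 hq.2 hpq h1]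
    simp
  | of_succ i hi ih =>
    set x : ℝ := (i : ℝ) / n with hx
    set y : ℝ := ((i + 1 : ℕ) : ℝ) / n with hy
    have hi0 : (0 : ℝ) < ((i + 1 : ℕ) : ℝ) := by positivity
    have hyx : y - x = 1 / n := by
      rw [hx, hy]
      push_cast
      ring
    have hx0 : 0 ≤ x := by positivity
    have hy0 : 0 < y := by positivity
    have hy1 : y ≤ 1 := by
      rw [hy, div_le_one hn0]
      exact_mod_cast hi
    have hxy : x ≤ y := by
      have : 0 < 1 / (n : ℝ) := by positivity
      linarith
    have hT := isTangent_limitValue hp0 hp.2 hq0 hq.2 hpq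
    have hxm : x ∈ Set.Icc (0 : ℝ) 1 := ⟨hx0, hxy.trans hy1⟩
    have hym : y ∈ Set.Icc (0 : ℝ) 1 := ⟨hy0.le, hy1⟩
    have t1 := mul_le_mul_of_nonneg_left (hT y hym x hxm) hn0.le
    have t2 := mul_le_mul_of_nonneg_left (hT x hxm y hym) hn0.le
    have e1 : (n : ℝ) * (limitValue p q y + (y - x) * limitSlope p q y) =
        n * limitValue p q y + limitSlope p q y := by
      rw [hyx]
      field_simp
    have e2 : (n : ℝ) * (limitValue p q x + (x - y) * limitSlope p q x) =
        n * limitValue p q x - limitSlope p q x := by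
      rw [← neg_sub y x, hyx]
      field_simp
      ring
    rw [e1] at t1
    rw [e2] at t2
    have hS : surplus p q (n * limitValue p q y / ((i + 1 : ℕ) : ℝ)) = limitSlope p q y := by
      rw [← limitSlope_eq_surplus hp hq hy0 hy1, hy]
      congr 1
      field_simp
    have hstep := optValue_eq (p := p) (q := q) (n := n) (i := i + 1) (by omega)
    have m1 := add_surplus_mono (p := p) hq0.le hq.2 (i := i + 1) (by omega) ih.1
    have m2 := surplus_anti (p := p) hq0.le hq.2 ((div_le_div_iff_of_pos_right hi0).2 ih.1)
    rw [hS] at m1 m2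
    refine ⟨?_, ?_⟩ <;> linarith [ih.2]

/-- An optimal threshold for `Y` is within `2` of `n * limitY p q`. -/
lemma threshold_Y_bounds (hp : p ∈ Set.Icc (1 / 2 : ℝ) 1) (hq : q ∈ Set.Icc (1 / 2 : ℝ) 1)
    (hn : 1 ≤ n) {tY tN : ℕ} (htY : 1 ≤ tY) (htYN : tY ≤ tN) (htN : tN ≤ n)
    (hopt : (thresholdPolicy n tY tN).IsOptimal p q) :
    limitY p q ≤ (tY : ℝ) / n ∧ (tY : ℝ) / n ≤ limitY p q + 2 / n := by
  have hn0 : (0 : ℝ) < n := by exact_mod_cast hn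
  have hp0 : 0 < p := by linarith [hp.1]
  have hq0 : 0 < q := by linarith [hq.1]
  have hq1 : 0 ≤ 1 - q := by linarith [hq.2]
  have hpq : 1 - q ≤ p := by linarith [hp.1, hq.1]
  have hL := one_sub_mul_limitOpt hp0 hq0 hq.2
  constructor
  · have h := (margin_of_isOptimal hp hq hn htN hopt htY htYN Signal.Y).1 le_rfl
    have hb := (optValue_bounds hp hq hn (htYN.trans htN)).1
    have ht0 : (0 : ℝ) < tY := by exact_mod_cast htY
    by_contra! hlt
    rw [limitValue_of_le_limitY hp0 hq0 hq.2 hpq hlt.le] at hb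
    simp only [margin, bestLaw, noise] at h
    rw [← mul_div_assoc, sub_nonneg, div_le_iff₀ ht0] at h
    rw [div_lt_iff₀ hn0] at hlt
    have h1 := mul_le_mul_of_nonneg_left hb hq1
    have h2 := mul_lt_mul_of_pos_left hlt hp0
    have h3 : (1 - q) * (n * limitOpt p q) = p * (limitY p q * n) := by
      linear_combination (n : ℝ) * hL
    linarith
  · obtain ⟨k, rfl⟩ : ∃ k, tY = k + 1 := ⟨tY - 1, by omega⟩
    have hk : ((k : ℝ)) / n ≤ limitY p q + 1 / n := by
      rcases Nat.eq_zero_or_pos k with rfl | hk0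
      · have := limitY_nonneg hp0 hq.2
        simp only [Nat.cast_zero, zero_div]
        positivity
      by_contra! hlt
      have h1n : 0 < 1 / (n : ℝ) := by positivity
      have h := (margin_of_isOptimal hp hq hn htN hopt hk0 (by omega) Signal.Y).2
        (Nat.lt_succ_self k)
      have hkn : k ≤ n := by omega
      have hk1 : (k : ℝ) / n ≤ 1 := by
        rw [div_le_one hn0]
        exact_mod_cast hkn
      have hb := (optValue_bounds hp hq hn hkn).2
      have hs := limitSlope_nonneg hp hq (x := (k : ℝ) / n) (by positivity) hk1
      have hw := limitValue_anti hp hq (limitY_nonneg hp0 hq.2)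
        (show limitY p q ≤ (k : ℝ) / n by linarith) hk1
      rw [limitValue_of_le_limitY hp0 hq0 hq.2 hpq le_rfl] at hw
      simp only [margin, bestLaw, noise] at h
      have hk0' : (0 : ℝ) < k := by exact_mod_cast hk0
      rw [← mul_div_assoc, sub_nonpos, le_div_iff₀ hk0'] at h
      have h1 : optValue p q n (k + 1) ≤ n * limitOpt p q + 1 := by
        have := mul_le_mul_of_nonneg_left hw hn0.le
        linarith
      have h2 := mul_le_mul_of_nonneg_left h1 hq1
      rw [lt_div_iff₀ hn0, add_mul, one_div_mul_cancel hn0.ne'] at hlt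
      have h3 := mul_lt_mul_of_pos_left hlt hp0
      have h4 : (1 - q) * (n * limitOpt p q) = p * (limitY p q * n) := by
        linear_combination (n : ℝ) * hL
      linarith
    have e : ((k + 1 : ℕ) : ℝ) / n = k / n + 1 / n := by push_cast; ring
    have e2 : (2 : ℝ) / n = 1 / n + 1 / n := by ring
    rw [e, e2]
    linarith

/-- An optimal threshold for `N` is within `2` of `n * limitN p q`. -/
lemma threshold_N_bounds (hp : p ∈ Set.Icc (1 / 2 : ℝ) 1) (hq : q ∈ Set.Icc (1 / 2 : ℝ) 1)
    (hn : 1 ≤ n) {tY tN : ℕ} (htY : 1 ≤ tY) (htYN : tY ≤ tN) (htN : tN ≤ n)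
    (hopt : (thresholdPolicy n tY tN).IsOptimal p q) :
    limitN p q ≤ (tN : ℝ) / n ∧ (tN : ℝ) / n ≤ limitN p q + 2 / n := by
  have hn0 : (0 : ℝ) < n := by exact_mod_cast hn
  have hp0 : 0 < p := by linarith [hp.1]
  have hq0 : 0 < q := by linarith [hq.1]
  have hpq : 1 - q ≤ p := by linarith [hp.1, hq.1]
  have htN1 : 1 ≤ tN := htY.trans htYN
  constructor
  · have h := (margin_of_isOptimal hp hq hn htN hopt htN1 le_rfl Signal.N).1 le_rfl
    have ht0 : (0 : ℝ) < tN := by exact_mod_cast htN1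
    simp only [margin, bestLaw, noise] at h
    rw [← mul_div_assoc, sub_nonneg, div_le_iff₀ ht0] at h
    rcases hp.2.eq_or_lt with rfl | hp1
    -- for `p = 1` only the last `N` is accepted: before it, going on has a positive value
    · rcases htN.eq_or_lt with rfl | hlt
      · rw [div_self hn0.ne']
        exact limitN_le_one le_rfl hq0
      · have := one_le_optValue (q := q) zero_le_one le_rfl (Nat.succ_le_of_lt hlt)
        nlinarith
    · have hb := (optValue_bounds hp hq hn htN).1
      by_contra! hlt
      have hw := limitValue_anti hp hq (x := (tN : ℝ) / n) (by positivity) hlt.le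
        (limitN_le_one hp.2 hq0)
      rw [limitValue_of_limitN_le hp0 hq0 hq.2 hpq le_rfl, log_limitN] at hw
      rw [div_lt_iff₀ hn0] at hlt
      have h1 := mul_le_mul_of_nonneg_left hw (mul_nonneg hq0.le hn0.le)
      have h2 := mul_le_mul_of_nonneg_left hb hq0.le
      have h3 := mul_lt_mul_of_pos_left hlt (sub_pos.2 hp1)
      have h4 : q * n * -(limitN p q * (p / q - 1 / q)) = (1 - p) * (limitN p q * n) := by
        field_simp
        ring
      linarith
  · obtain ⟨k, rfl⟩ : ∃ k, tN = k + 1 := ⟨tN - 1, by omega⟩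
    have hk : ((k : ℝ)) / n ≤ limitN p q + 1 / n := by
      have hθ := limitN_pos (p := p) (q := q)
      rcases Nat.eq_zero_or_pos k with rfl | hk0
      · simp only [Nat.cast_zero, zero_div]
        positivity
      by_contra! hlt
      have h1n : 0 < 1 / (n : ℝ) := by positivity
      have h := (margin_of_isOptimal hp hq hn htN hopt hk0 (by omega) Signal.N).2
        (Nat.lt_succ_self k)
      have hkn : k ≤ n := by omega
      have hk1 : (k : ℝ) / n ≤ 1 := by
        rw [div_le_one hn0]
        exact_mod_cast hkn
      have hk0' : (0 : ℝ) < k := by exact_mod_cast hk0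
      have hx0 : 0 < (k : ℝ) / n := by positivity
      have hb := (optValue_bounds hp hq hn hkn).2
      have hs := limitSlope_nonneg hp hq (x := (k : ℝ) / n) hx0.le hk1
      rw [limitValue_of_limitN_le hp0 hq0 hq.2 hpq (by linarith)] at hb
      simp only [margin, bestLaw, noise] at h
      rw [← mul_div_assoc, sub_nonpos, le_div_iff₀ hk0'] at h
      -- `log (x / limitN) ≥ 1 - limitN / x` at `x = k / n`
      have hlog := Real.one_sub_inv_le_log_of_pos (div_pos hx0 hθ)
      rw [Real.log_div hx0.ne' hθ.ne', log_limitN, inv_div] at hlog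
      have h1 := mul_le_mul_of_nonneg_left hlog (mul_nonneg hq0.le hk0'.le)
      have e1 : q * k * (1 - limitN p q / (k / n)) = q * (k - limitN p q * n) := by
        field_simp
      have e2 : q * k * (Real.log (k / n) - (p / q - 1 / q)) =
          q * (k * Real.log (k / n)) + (1 - p) * k := by
        field_simp
        ring
      rw [e1, e2] at h1
      have e3 : (n : ℝ) * -((k : ℝ) / n * Real.log (k / n)) = -(k * Real.log (k / n)) := by
        field_simp
      rw [e3] at hb
      have h2 : optValue p q n (k + 1) ≤ -(k * Real.log (k / n)) + 1 := by linarith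
      have h3 := mul_le_mul_of_nonneg_left h2 hq0.le
      rw [lt_div_iff₀ hn0, add_mul, one_div_mul_cancel hn0.ne'] at hlt
      have h4 := mul_lt_mul_of_pos_left hlt hq0
      linarith
    have e : ((k + 1 : ℕ) : ℝ) / n = k / n + 1 / n := by push_cast; ring
    have e2 : (2 : ℝ) / n = 1 / n + 1 / n := by ring
    rw [e, e2]
    linarith

lemma optN_bounds (hp : p ∈ Set.Icc (1 / 2 : ℝ) 1) (hq : q ∈ Set.Icc (1 / 2 : ℝ) 1)
    (hn : 1 ≤ n) : limitOpt p q ≤ optN n p q ∧ optN n p q ≤ limitOpt p q + 1 / n := by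
  have hn0 : (0 : ℝ) < n := by exact_mod_cast hn
  have hp0 : 0 < p := by linarith [hp.1]
  have hq0 : 0 < q := by linarith [hq.1]
  have hpq : 1 - q ≤ p := by linarith [hp.1, hq.1]
  have h := optValue_bounds hp hq hn (Nat.zero_le n)
  have hs := limitSlope_nonneg hp hq le_rfl zero_le_one
  simp only [Nat.cast_zero, zero_div, zero_add] at h
  rw [limitValue_of_le_limitY hp0 hq0 hq.2 hpq (limitY_nonneg hp0 hq.2)] at h
  rw [optN_eq hp hq hn, one_div, inv_mul_eq_div]
  constructor
  · rw [le_div_iff₀ hn0]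
    linarith [h.1]
  · rw [div_le_iff₀ hn0, add_mul, inv_mul_cancel₀ hn0.ne']
    linarith [h.2]

end Comparison

lemma tendsto_of_bounds {u : ℕ → ℝ} {a c : ℝ}
    (h : ∀ n : ℕ, 1 ≤ n → a ≤ u n ∧ u n ≤ a + c / n) :
    Filter.Tendsto u Filter.atTop (nhds a) := by
  have hlim : Filter.Tendsto (fun n : ℕ => a + c / (n : ℝ)) Filter.atTop (nhds a) := by
    simpa using (tendsto_const_div_atTop_nhds_zero_nat c).const_add a
  refine tendsto_of_tendsto_of_tendsto_of_le_of_le' tendsto_const_nhds hlim ?_ ?_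
  · filter_upwards [Filter.eventually_ge_atTop 1] with n hn using (h n hn).1
  · filter_upwards [Filter.eventually_ge_atTop 1] with n hn using (h n hn).2

end BinaryAdvice

theorem mainTheorem10 (p p' : ℝ) (hp : p ∈ Set.Icc (1 / 2 : ℝ) 1)
    (hp' : p' ∈ Set.Icc (1 / 2 : ℝ) 1) :
    (∀ n : ℕ, 1 ≤ n → ∃ tY tN : ℕ, 1 ≤ tY ∧ tY ≤ tN ∧ tN ≤ n ∧
        (BinaryAdvice.thresholdPolicy n tY tN).IsOptimal p p' ∧
        (BinaryAdvice.thresholdPolicy n tY tN).successProb p p' = BinaryAdvice.optN n p p') ∧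
      (∀ tY tN : ℕ → ℕ,
        (∀ n : ℕ, 1 ≤ n → 1 ≤ tY n ∧ tY n ≤ tN n ∧ tN n ≤ n ∧
          (BinaryAdvice.thresholdPolicy n (tY n) (tN n)).IsOptimal p p') →
        Filter.Tendsto (fun n : ℕ => (tY n : ℝ) / (n : ℝ)) Filter.atTop
            (nhds (((1 - p') / p) ^ (1 / p') * Real.exp (p / p' - 1 / p'))) ∧
          Filter.Tendsto (fun n : ℕ => (tN n : ℝ) / (n : ℝ)) Filter.atTop
            (nhds (Real.exp (p / p' - 1 / p')))) ∧
      Filter.Tendsto (fun n : ℕ => BinaryAdvice.optN n p p') Filter.atTop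
        (nhds (((1 - p') / p) ^ ((1 - p') / p') * Real.exp (p / p' - 1 / p'))) ∧
      ((1 - p') / p) ^ ((1 - p') / p') * Real.exp (p / p' - 1 / p') ≤ BinaryAdvice.opt p p' := by
  refine ⟨fun n hn => ?_, fun tY tN h => ⟨?_, ?_⟩, ?_, ?_⟩
  · obtain ⟨tY, tN, h1, h2, h3, h⟩ := BinaryAdvice.exists_thresholds hp hp' hn
    have hs := BinaryAdvice.thresholdPolicy_successProb_of_margin hn h
    refine ⟨tY, tN, h1, h2, h3, fun π => ?_, hs.trans (BinaryAdvice.optN_eq hp hp' hn).symm⟩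
    rw [hs]
    exact π.successProb_le hn (by linarith [hp'.1]) hp'.2
  · refine BinaryAdvice.tendsto_of_bounds (c := 2) fun n hn => ?_
    obtain ⟨h1, h2, h3, h4⟩ := h n hn
    exact BinaryAdvice.threshold_Y_bounds hp hp' hn h1 h2 h3 h4
  · refine BinaryAdvice.tendsto_of_bounds (c := 2) fun n hn => ?_
    obtain ⟨h1, h2, h3, h4⟩ := h n hn
    exact BinaryAdvice.threshold_N_bounds hp hp' hn h1 h2 h3 h4
  · exact BinaryAdvice.tendsto_of_bounds (c := 1) fun n hn => BinaryAdvice.optN_bounds hp hp' hn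
  · refine le_csInf ⟨_, 1, le_rfl, rfl⟩ ?_
    rintro v ⟨n, hn, rfl⟩
    exact (BinaryAdvice.optN_bounds hp hp' hn).1
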